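/- Let $K$ be a field, let $n,m$ be integers with $1\le m\le n-1$, and let $G$ be the graph with vertex set $[n]=\{1,\dots,n\}$ and edge set $$E(G)=\big\{\{i,j\}:1\le i<j\le n-1\big\}\cup\big\{\{m,n\},\{m+1,n\},\dots,\{n-1,n\}\big\},$$ that is, the complete graph on $[n-1]$ together with a vertex $n$ adjacent exactly to $m,m+1,\dots,n-1$. Let $J_G=(x_iy_j-x_jy_i:\{i,j\}\in E(G))$ be the binomial edge ideal of $G$ in the standard graded polynomial ring $S=K[x_1,\dots,x_n,y_1,\dots,y_n]$. Then $$\operatorname{proj\,dim}(J_G)\le 2n-m-3\qquad\text{and}\qquad \operatorname{reg}(J_G)\le 3.$$ Here, for a graded ideal $I\subset S$ with minimal graded free resolution $\cdots\to F_1\to F_0\to I\to 0$, $F_i=\bigoplus_j S(-j)^{\beta_{i,j}(I)}$, one sets $\operatorname{proj\,dim}(I)=\max\{i:\beta_{i,j}(I)\ne0\text{ for some }j\}$ and $\operatorname{reg}(I)=\max\{j-i:\beta_{i,j}(I)\ne0\text{ for some } i,j\}$. -/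

import Mathlib

open MvPolynomial

/-- The binomial edge ideal `J_G = (x_i y_j - x_j y_i : {i, j} ∈ E(G))` of a graph `G` with
vertex set `V`, in the polynomial ring `K[x_v, y_v : v ∈ V]`. The variable `x_v` is
`X (Sum.inl v)` and the variable `y_v` is `X (Sum.inr v)`. -/
noncomputable def binomialEdgeIdeal (K : Type*) [Field K] {V : Type*} (G : SimpleGraph V) :
    Ideal (MvPolynomial (V ⊕ V) K) :=
  Ideal.span {f | ∃ i j : V, G.Adj i j ∧
    f = X (Sum.inl i) * X (Sum.inr j) - X (Sum.inl j) * X (Sum.inr i)}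

/-- The graph on the vertices labelled `1, …, n` whose edges are `{i, j}` for
`1 ≤ i < j ≤ n - 1` and `{i, n}` for `m ≤ i ≤ n - 1`.
The element `a : Fin n` (with value `0, …, n - 1`) is the vertex with label `a + 1`. -/
def completeWithVertex (n m : ℕ) : SimpleGraph (Fin n) :=
  SimpleGraph.fromRel fun a b =>
    let i := (a : ℕ) + 1
    let j := (b : ℕ) + 1
    (i < j ∧ j ≤ n - 1) ∨ ((m ≤ i ∧ i ≤ n - 1) ∧ j = n)

section GradedResolutions

variable {σ K : Type*} [Field K]

/-- `v` is a homogeneous element of degree `d` of the graded free module `⨁ₐ R(-deg a)`,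
`R = K[σ]` with the standard grading: each coordinate `v a` vanishes or is a form of degree
`d - deg a`. -/
def IsHomogeneousVector {r : ℕ} (deg : Fin r → ℕ) (d : ℕ)
    (v : Fin r → MvPolynomial σ K) : Prop :=
  ∀ a, v a = 0 ∨ ∃ k, k + deg a = d ∧ (v a).IsHomogeneous k

/-- A minimal graded free resolution
`⋯ → F₂ → F₁ → F₀ → I → 0` of an ideal `I` of the standard graded polynomial ring
`R = K[σ]`, with `F_i = ⨁_b R(-deg i b)` of finite rank, differentials homogeneous of degree
zero, and the image of each differential `F_{i+1} → F_i` contained in `𝔪 F_i`, where `𝔪` is the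
ideal generated by the variables. -/
structure MinimalGradedFreeResolution (I : Ideal (MvPolynomial σ K)) where
  /-- the rank of `F_i` -/
  rank : ℕ → ℕ
  /-- the degrees of the basis elements of `F_i` -/
  deg : ∀ i, Fin (rank i) → ℕ
  /-- the augmentation `F₀ → I` -/
  aug : (Fin (rank 0) → MvPolynomial σ K) →ₗ[MvPolynomial σ K] I
  /-- the differential `F_{i+1} → F_i` -/
  d : ∀ i, (Fin (rank (i + 1)) → MvPolynomial σ K) →ₗ[MvPolynomial σ K]
    (Fin (rank i) → MvPolynomial σ K)
  aug_surjective : Function.Surjective aug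
  exact_zero : Function.Exact (d 0) aug
  exact_succ : ∀ i, Function.Exact (d (i + 1)) (d i)
  aug_homogeneous : ∀ b, ((aug (Pi.single b 1) : I) : MvPolynomial σ K).IsHomogeneous (deg 0 b)
  d_homogeneous : ∀ i b, IsHomogeneousVector (deg i) (deg (i + 1) b) (d i (Pi.single b 1))
  minimal : ∀ i v a, d i v a ∈ Ideal.span (Set.range (X : σ → MvPolynomial σ K))

/-- The exponent of `R(-j)` in the `i`-th module of a minimal graded free resolution. -/
def MinimalGradedFreeResolution.betti {I : Ideal (MvPolynomial σ K)}
    (F : MinimalGradedFreeResolution I) (i j : ℕ) : ℕ :=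
  (Finset.univ.filter fun b => F.deg i b = j).card

/-- The graded Betti number `β_{i,j}(I)`: the exponent of `R(-j)` in the `i`-th module of a
minimal graded free resolution of `I`. All minimal graded free resolutions of `I` are isomorphic,
so the supremum is that of a constant family; the family is nonempty for every graded ideal of a
polynomial ring in finitely many variables, see `exists_minimalGradedFreeResolution`. -/
noncomputable def gradedBetti (I : Ideal (MvPolynomial σ K)) (i j : ℕ) : ℕ∞ :=
  ⨆ F : MinimalGradedFreeResolution I, (F.betti i j : ℕ∞)

/-- `proj dim (I) = max {i : β_{i,j}(I) ≠ 0 for some j}` (`⊤` if unbounded, `⊥` for `I = 0`). -/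
noncomputable def projDim (I : Ideal (MvPolynomial σ K)) : WithBot ℕ∞ :=
  ⨆ (i : ℕ) (j : ℕ) (_ : gradedBetti I i j ≠ 0), ((i : ℕ∞) : WithBot ℕ∞)

/-- `reg (I) = max {j - i : β_{i,j}(I) ≠ 0}` (`⊤` if unbounded, `⊥` for `I = 0`). -/
noncomputable def regularity (I : Ideal (MvPolynomial σ K)) : WithBot (WithTop ℤ) :=
  ⨆ (i : ℕ) (j : ℕ) (_ : gradedBetti I i j ≠ 0),
    ((((j : ℤ) - (i : ℤ) : ℤ) : WithTop ℤ) : WithBot (WithTop ℤ))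

end GradedResolutions

section Existence

variable {σ K : Type*} [Field K]

theorem homogeneousComponent_mul_of_isHomogeneous {e : ℕ} (p : MvPolynomial σ K)
    {q : MvPolynomial σ K} (hq : q.IsHomogeneous e) (d : ℕ) :
    homogeneousComponent d (p * q) =
      if e ≤ d then homogeneousComponent (d - e) p * q else 0 := by
  classical
  let _ : GradedAlgebra (homogeneousSubmodule σ K) := gradedAlgebra
  have key : ∀ r i, homogeneousComponent i r =
      (DirectSum.decompose (homogeneousSubmodule σ K) r i : MvPolynomial σ K) := by
    intro r i
    exact (decomposition.decompose'_apply r i).symm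
  split_ifs with h
  · rw [key, key]
    exact DirectSum.coe_decompose_mul_of_right_mem_of_le _ hq h
  · rw [key]
    exact DirectSum.coe_decompose_mul_of_right_mem_of_not_le _ hq h

/-- The degree `d` component of an element of the graded free module `⨁ₐ R(-deg a)`. -/
noncomputable def vectorComponent {r : ℕ} (deg : Fin r → ℕ) (d : ℕ)
    (v : Fin r → MvPolynomial σ K) : Fin r → MvPolynomial σ K :=
  fun a => if deg a ≤ d then homogeneousComponent (d - deg a) (v a) else 0

theorem isHomogeneousVector_vectorComponent {r : ℕ} (deg : Fin r → ℕ) (d : ℕ)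
    (v : Fin r → MvPolynomial σ K) : IsHomogeneousVector deg d (vectorComponent deg d v) := by
  intro a
  unfold vectorComponent
  split_ifs with h
  · exact Or.inr ⟨d - deg a, by omega, homogeneousComponent_isHomogeneous _ _⟩
  · exact Or.inl rfl

theorem vectorComponent_smul {r : ℕ} (deg : Fin r → ℕ) (d e : ℕ) (p : MvPolynomial σ K)
    {v : Fin r → MvPolynomial σ K} (hv : IsHomogeneousVector deg e v) :
    vectorComponent deg d (p • v) =
      (if e ≤ d then homogeneousComponent (d - e) p else 0) • v := by
  funext a
  simp only [vectorComponent, Pi.smul_apply, smul_eq_mul]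
  rcases hv a with h0 | ⟨k, hk, hh⟩
  · simp [h0]
  · rw [homogeneousComponent_mul_of_isHomogeneous p hh]
    by_cases h1 : e ≤ d
    · have h2 : deg a ≤ d := by omega
      have h3 : k ≤ d - deg a := by omega
      have h4 : d - deg a - k = d - e := by omega
      simp [h1, h2, h3, h4]
    · by_cases h2 : deg a ≤ d
      · have h3 : ¬ k ≤ d - deg a := by omega
        simp [h1, h3]
      · simp [h1, h2]

theorem vectorComponent_sum {r : ℕ} (deg : Fin r → ℕ) (d : ℕ) {ι : Type*} (s : Finset ι)
    (f : ι → Fin r → MvPolynomial σ K) :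
    vectorComponent deg d (∑ i ∈ s, f i) = ∑ i ∈ s, vectorComponent deg d (f i) := by
  funext a
  simp only [vectorComponent, Finset.sum_apply]
  split_ifs <;> simp

theorem exists_sum_vectorComponent {r : ℕ} (deg : Fin r → ℕ) (v : Fin r → MvPolynomial σ K) :
    ∃ D, ∑ d ∈ Finset.range D, vectorComponent deg d v = v := by
  refine ⟨∑ a, (deg a + (v a).totalDegree + 1), ?_⟩
  funext a
  have hD := Finset.single_le_sum (f := fun a => deg a + (v a).totalDegree + 1)
    (fun _ _ => Nat.zero_le _) (Finset.mem_univ a)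
  set D := ∑ a, (deg a + (v a).totalDegree + 1)
  simp only [Finset.sum_apply, vectorComponent]
  have h1 : ∀ d ∈ Finset.range D, d ∉ (Finset.range (D - deg a)).image (· + deg a) →
      (if deg a ≤ d then homogeneousComponent (d - deg a) (v a) else 0) = 0 := by
    intro d hd hd'
    rw [if_neg]
    intro h
    apply hd'
    simp only [Finset.mem_image, Finset.mem_range] at hd ⊢
    exact ⟨d - deg a, by omega, by omega⟩
  rw [← Finset.sum_subset (s₁ := (Finset.range (D - deg a)).image (· + deg a)) ?_ h1,
    Finset.sum_image (by intro x _ y _ h; simpa using h)]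
  · simp only [Nat.le_add_left, if_true, Nat.add_sub_cancel]
    conv_rhs => rw [← sum_homogeneousComponent (v a)]
    symm
    apply Finset.sum_subset
    · intro x
      simp only [Finset.mem_range]
      omega
    · intro x _ hx
      apply homogeneousComponent_eq_zero
      simp only [Finset.mem_range] at hx
      omega
  · intro x
    simp only [Finset.mem_image, Finset.mem_range]
    rintro ⟨y, hy, rfl⟩
    omega

/-- A graded submodule of a graded free module of finite rank has a minimal graded free cover. -/
theorem exists_minimal_cover [Finite σ] {r : ℕ} (deg : Fin r → ℕ)
    (N : Submodule (MvPolynomial σ K) (Fin r → MvPolynomial σ K))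
    (hN : ∀ v ∈ N, ∀ d, vectorComponent deg d v ∈ N) :
    ∃ (s : ℕ) (e : Fin s → ℕ)
      (φ : (Fin s → MvPolynomial σ K) →ₗ[MvPolynomial σ K] (Fin r → MvPolynomial σ K)),
      LinearMap.range φ = N ∧
      (∀ b, IsHomogeneousVector deg (e b) (φ (Pi.single b 1))) ∧
      (∀ v ∈ LinearMap.ker φ, ∀ d, vectorComponent e d v ∈ LinearMap.ker φ) ∧
      (∀ v ∈ LinearMap.ker φ, ∀ a,
        v a ∈ Ideal.span (Set.range (X : σ → MvPolynomial σ K))) := by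
  classical
  let P : ℕ → Prop := fun s => ∃ (e : Fin s → ℕ) (g : Fin s → Fin r → MvPolynomial σ K),
    (∀ b, IsHomogeneousVector deg (e b) (g b)) ∧
      Submodule.span (MvPolynomial σ K) (Set.range g) = N
  have hP : ∃ s, P s := by
    let H : Set (Fin r → MvPolynomial σ K) := {v | v ∈ N ∧ ∃ d, IsHomogeneousVector deg d v}
    have hH : Submodule.span (MvPolynomial σ K) H = N := by
      apply le_antisymm
      · exact Submodule.span_le.2 fun v hv => hv.1
      · intro v hv
        obtain ⟨D, hD⟩ := exists_sum_vectorComponent deg v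
        rw [← hD]
        exact Submodule.sum_mem _ fun d _ => Submodule.subset_span
          ⟨hN v hv d, d, isHomogeneousVector_vectorComponent deg d v⟩
    have hfg : (Submodule.span (MvPolynomial σ K) H).FG := IsNoetherian.noetherian _
    obtain ⟨T, hT, hT'⟩ := (Submodule.fg_span_iff_fg_span_finset_subset H).1 hfg
    have hhom : ∀ t : T, ∃ d, IsHomogeneousVector deg d (t : Fin r → MvPolynomial σ K) :=
      fun t => (hT t.2).2
    choose e he using hhom
    refine ⟨T.card, fun b => e (T.equivFin.symm b), fun b => (T.equivFin.symm b : _),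
      fun b => he _, ?_⟩
    rw [← hH, hT']
    congr 1
    ext v
    constructor
    · rintro ⟨b, rfl⟩
      exact (T.equivFin.symm b).2
    · intro hv
      exact ⟨T.equivFin ⟨v, hv⟩, by simp⟩
  obtain ⟨e, g, hg, hspan⟩ := Nat.find_spec hP
  have hmin : ∀ t, t < Nat.find hP → ¬ P t := fun t ht => Nat.find_min hP ht
  generalize Nat.find hP = s at e g hg hspan hmin
  have hφ : ∀ v, Fintype.linearCombination (MvPolynomial σ K) g v = ∑ b, v b • g b :=
    fun v => Fintype.linearCombination_apply _ _ _
  have hker : ∀ v : Fin s → MvPolynomial σ K, ∑ b, v b • g b = 0 → ∀ d, ∑ b, vectorComponent e d v b • g b = 0 := by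
    intro v hv d
    have h := vectorComponent_sum deg d Finset.univ (fun b : Fin s => v b • g b)
    rw [hv] at h
    have h0 : vectorComponent deg d (0 : Fin r → MvPolynomial σ K) = 0 := by
      funext a; simp [vectorComponent]
    rw [h0] at h
    rw [h]
    refine Finset.sum_congr rfl fun b _ => ?_
    rw [vectorComponent_smul deg d (e b) (v b) (hg b)]
    rfl
  refine ⟨s, e, Fintype.linearCombination (MvPolynomial σ K) g, ?_, ?_, ?_, ?_⟩
  · rw [Fintype.range_linearCombination, hspan]
  · intro b
    rw [Fintype.linearCombination_apply_single, one_smul]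
    exact hg b
  · intro v hv d
    rw [LinearMap.mem_ker, hφ] at hv ⊢
    exact hker v hv d
  · intro v hv a
    rw [LinearMap.mem_ker, hφ] at hv
    have hcc : constantCoeff (v a) = 0 := by
      by_contra hc
      obtain ⟨t, rfl⟩ : ∃ t, s = t + 1 := ⟨s - 1, by have := a.2; omega⟩
      have hw := hker v hv (e a)
      set w := vectorComponent e (e a) v with hwdef
      have hwa : w a = C (constantCoeff (v a)) := by
        simp [hwdef, vectorComponent, homogeneousComponent_zero, constantCoeff_eq]
      rw [Fin.sum_univ_succAbove _ a, hwa] at hw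
      refine hmin t (Nat.lt_succ_self t)
        ⟨fun b => e (a.succAbove b), fun b => g (a.succAbove b), fun b => hg _, ?_⟩
      rw [← hspan]
      apply le_antisymm
      · refine Submodule.span_mono ?_
        rintro _ ⟨b, rfl⟩
        exact ⟨_, rfl⟩
      · refine Submodule.span_le.2 ?_
        rintro _ ⟨b, rfl⟩
        rcases Fin.eq_self_or_eq_succAbove a b with rfl | ⟨b', rfl⟩
        · have h1 : g b = (C (constantCoeff (v b))⁻¹ : MvPolynomial σ K) •
              -(∑ i, w (b.succAbove i) • g (b.succAbove i)) := by
            rw [← eq_neg_of_add_eq_zero_left hw, smul_smul, ← C_mul, inv_mul_cancel₀ hc,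
              C_1, one_smul]
          rw [h1]
          refine Submodule.smul_mem _ _ (Submodule.neg_mem _ (Submodule.sum_mem _ fun i _ => ?_))
          exact Submodule.smul_mem _ _ (Submodule.subset_span ⟨i, rfl⟩)
        · exact Submodule.subset_span ⟨b', rfl⟩
    rw [← Set.image_univ, mem_ideal_span_X_image]
    intro mon hmon
    by_contra hcon
    push Not at hcon
    have : mon = 0 := by ext i; simpa using hcon i
    rw [mem_support_iff, this] at hmon
    exact hmon (by simpa [constantCoeff_eq] using hcc)

/-- Every graded ideal of a polynomial ring in finitely many variables over a field has a minimal
graded free resolution. -/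
theorem exists_minimalGradedFreeResolution [Finite σ] (I : Ideal (MvPolynomial σ K))
    (hI : ∀ f ∈ I, ∀ d, homogeneousComponent d f ∈ I) :
    Nonempty (MinimalGradedFreeResolution I) := by
  classical
  -- a stage of the construction: a graded free module with a graded submodule (the kernel)
  let St := {p : Σ r : ℕ, (Fin r → ℕ) ×
      Submodule (MvPolynomial σ K) (Fin r → MvPolynomial σ K) //
    ∀ v ∈ p.2.2, ∀ d, vectorComponent p.2.1 d v ∈ p.2.2}
  have hstep : ∀ p : St, ∃ (q : St)
      (φ : (Fin q.1.1 → MvPolynomial σ K) →ₗ[MvPolynomial σ K] (Fin p.1.1 → MvPolynomial σ K)),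
      LinearMap.range φ = p.1.2.2 ∧
      (∀ b, IsHomogeneousVector p.1.2.1 (q.1.2.1 b) (φ (Pi.single b 1))) ∧
      q.1.2.2 = LinearMap.ker φ ∧
      (∀ v ∈ LinearMap.ker φ, ∀ a,
        v a ∈ Ideal.span (Set.range (X : σ → MvPolynomial σ K))) := by
    rintro ⟨⟨r, deg, N⟩, hN⟩
    obtain ⟨s, e, φ, h1, h2, h3, h4⟩ := exists_minimal_cover deg N hN
    exact ⟨⟨⟨s, e, LinearMap.ker φ⟩, h3⟩, φ, h1, h2, rfl, h4⟩
  choose next φ hrange hhom hkernel hmin using hstep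
  let N₀ : Submodule (MvPolynomial σ K) (Fin 1 → MvPolynomial σ K) :=
    Submodule.comap (LinearMap.proj 0) I
  have hN₀ : ∀ v ∈ N₀, ∀ d, vectorComponent (fun _ : Fin 1 => 0) d v ∈ N₀ := by
    intro v hv d
    change homogeneousComponent d (v 0) ∈ I
    have hv' : v 0 ∈ I := hv
    exact hI _ hv' d
  let p₀ : St := ⟨⟨1, fun _ => 0, N₀⟩, hN₀⟩
  let st : ℕ → St := fun i => Nat.rec (next p₀) (fun _ p => next p) i
  let pr : (Fin 1 → MvPolynomial σ K) →ₗ[MvPolynomial σ K] MvPolynomial σ K := LinearMap.proj 0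
  have haug : ∀ v, (pr ∘ₗ φ p₀) v ∈ I := by
    intro v
    have : φ p₀ v ∈ N₀ := by
      have h := hrange p₀
      change _ = N₀ at h
      rw [← h]
      exact ⟨v, rfl⟩
    exact this
  have hpr : ∀ v, pr v = 0 ↔ v = 0 := by
    intro v
    constructor
    · intro h
      funext a
      rw [Subsingleton.elim a 0]
      exact h
    · rintro rfl; simp
  refine ⟨{
    rank := fun i => (st i).1.1
    deg := fun i => (st i).1.2.1
    aug := LinearMap.codRestrict I (pr ∘ₗ φ p₀) haug
    d := fun i => φ (st i)
    aug_surjective := ?_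
    exact_zero := ?_
    exact_succ := ?_
    aug_homogeneous := ?_
    d_homogeneous := fun i b => hhom (st i) b
    minimal := ?_ }⟩
  · rintro ⟨f, hf⟩
    have h : (fun _ => f : Fin 1 → MvPolynomial σ K) ∈ LinearMap.range (φ p₀) := by
      rw [hrange p₀]
      exact hf
    obtain ⟨v, hv⟩ := h
    refine ⟨v, Subtype.ext ?_⟩
    change φ p₀ v 0 = f
    rw [hv]
  · rw [LinearMap.exact_iff, hrange, LinearMap.ker_codRestrict]
    change _ = (next p₀).1.2.2
    rw [hkernel p₀]
    ext v
    rw [LinearMap.mem_ker, LinearMap.mem_ker, LinearMap.comp_apply, hpr]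
  · intro i
    rw [LinearMap.exact_iff, hrange]
    exact (hkernel (st i)).symm
  · intro b
    rcases hhom p₀ b 0 with h | ⟨k, hk, h⟩
    · change (φ p₀ (Pi.single b 1) 0).IsHomogeneous _
      rw [h]
      exact isHomogeneous_zero _ _ _
    · have hk' : k = (next p₀).1.2.1 b := hk
      rw [hk'] at h
      exact h
  · intro i v a
    have h : φ (st i) v ∈ (st i).1.2.2 := by
      rw [← hrange]
      exact ⟨v, rfl⟩
    cases i with
    | zero =>
      refine hmin p₀ _ ?_ a
      rw [← hkernel]
      exact h
    | succ i =>
      refine hmin (st i) _ ?_ a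
      rw [← hkernel]
      exact h

/-- Binomial edge ideals are graded. -/
theorem homogeneousComponent_mem_binomialEdgeIdeal {V : Type*} (G : SimpleGraph V) :
    ∀ f ∈ binomialEdgeIdeal K G, ∀ d, homogeneousComponent d f ∈ binomialEdgeIdeal K G := by
  let _ : GradedAlgebra (homogeneousSubmodule (V ⊕ V) K) := gradedAlgebra
  intro f hf d
  refine homogeneousComponent_mem_of_mem ?_ hf d
  refine Ideal.homogeneous_span _ _ ?_
  rintro _ ⟨i, j, _, rfl⟩
  exact ⟨2, ((isHomogeneous_X K _).mul (isHomogeneous_X K _)).sub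
    ((isHomogeneous_X K _).mul (isHomogeneous_X K _))⟩

end Existence

/-!
Write `S = K[x_1, …, x_n, y_1, …, y_n]`, and let `w` be the last vertex, `U` the set of the others
and `C` the set of neighbours of `w`. The numbers `β_{i,j}` are read off from Koszul homology, and
the Koszul homology of `S / J_G` is bounded by adding one variable at a time.

*Koszul homology.* `CyclicBound I p r` says that the Koszul homology of `S / I` vanishes in
homological degree `i` and coefficient degree `c` (total degree `i + c`) unless `i ≤ p` and
`c ≤ r`. For a variable `v` and a graded ideal `I`, the long exact sequence of
`0 → S/(I : v)(-1) → S/I → S/(I + v) → 0` yields three rules: bounds for `I : v` and `I + v` give one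
for `I` (`CyclicBound.of_colon`), and if `v` is regular on `S / I`, then bounds can be passed from
`I` to `I + v` (`CyclicBound.sup_X`) and, because `v` annihilates Koszul homology, back
(`CyclicBound.of_sup_X`). The bounds for ideals generated by variables, including the zero ideal,
follow by descent from the residue field (`cyclicBound_span_X`). If `F` is a minimal graded free
resolution of `I`, then dimension shifting along `F` identifies the generators of `F_i` with Koszul
homology of `S / I` in degree `i + 1`, so that `CyclicBound I` bounds the projective dimension and
the regularity of `I` (`CyclicBound.projDim_le`, `CyclicBound.regularity_le`).

*The binomial edge ideal.* The variable `x_w` is regular on `S / J_G`: the ideal `J_G` is spanned by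
the differences of monomials with the same `coneInvariant`, and the invariant of `x_w u` determines
that of `u` (`mem_edgeIdeal_of_X_mul_mem`). Modulo `x_w`, the colon ideal by `y_w` is
`(x_w) + (x_c : c ∈ C) + J_U`, with `J_U` the ideal of the complete graph on `U`, and adding `y_w`
gives `(x_w, y_w) + J_U` (`CyclicBound.cone`). For `C = U` this is an inductive proof of the
bounds for complete graphs (`cyclicBound_clique`). In general, the colon ideal is treated by adding
the `y_c` with `c ∈ C` one after the other. Every colon ideal that occurs is generated by variables,
and the last ideal is that of the complete graph on `U \ C` together with variables
(`cyclicBound_colon`).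
-/

/-! ### The Koszul complex -/

section Koszul

variable {σ : Type*} [Fintype σ]

/-- The sign of `e_v ∧ e_A`: the parity of the number of elements of `A` that precede `v` in an
arbitrary fixed enumeration of the variables. -/
noncomputable def koszulSign (v : σ) (A : Finset σ) : ℤ :=
  (-1) ^ (A.filter fun u => Fintype.equivFin σ u < Fintype.equivFin σ v).card

theorem koszulSign_mul_self (v : σ) (A : Finset σ) : koszulSign v A * koszulSign v A = 1 := by
  unfold koszulSign
  rw [← mul_pow]
  simp

variable [DecidableEq σ]

/-- Exchanging two factors of a wedge product changes the sign. -/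
theorem koszulSign_mul_insert {v w : σ} {A : Finset σ} (hvw : v ≠ w) (hv : v ∉ A) (hw : w ∉ A) :
    koszulSign v A * koszulSign w (insert v A) = -(koszulSign w A * koszulSign v (insert w A)) := by
  have hne : Fintype.equivFin σ v ≠ Fintype.equivFin σ w :=
    fun h => hvw ((Fintype.equivFin σ).injective h)
  unfold koszulSign
  rw [Finset.filter_insert, Finset.filter_insert]
  rcases lt_or_gt_of_ne hne with h | h
  · rw [if_pos h, if_neg h.le.not_gt, Finset.card_insert_of_notMem (by simp [hv])]
    ring
  · rw [if_neg h.le.not_gt, if_pos h, Finset.card_insert_of_notMem (by simp [hw])]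
    ring

variable (K : Type*) [Field K] {M : Type*} [AddCommGroup M] [Module (MvPolynomial σ K) M]

/-- The differential of the Koszul complex of all the variables with coefficients in `M`. A chain
is a function `ω : Finset σ → M`, whose value at `A` is the coefficient of the exterior monomial
`e_A`. -/
noncomputable def koszulD : (Finset σ → M) →ₗ[MvPolynomial σ K] (Finset σ → M) :=
  LinearMap.pi fun A => ∑ v ∈ Aᶜ, koszulSign v A • (X v : MvPolynomial σ K) •
    (LinearMap.proj (insert v A) : (Finset σ → M) →ₗ[MvPolynomial σ K] M)

theorem koszulD_apply (ω : Finset σ → M) (A : Finset σ) :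
    koszulD K ω A =
      ∑ v ∈ Aᶜ, koszulSign v A • (X v : MvPolynomial σ K) • ω (insert v A) := by
  simp [koszulD, LinearMap.sum_apply]

theorem koszulD_koszulD (ω : Finset σ → M) : koszulD K (koszulD K ω) = 0 := by
  funext A
  simp only [koszulD_apply, Finset.smul_sum, Pi.zero_apply]
  rw [Finset.sum_sigma']
  refine Finset.sum_involution (fun p _ => ⟨p.2, p.1⟩) ?_ ?_ ?_ ?_
  · rintro ⟨v, w⟩ h
    simp only [Finset.mem_sigma, Finset.mem_compl, Finset.mem_insert, not_or] at h
    obtain ⟨hv, hwv, hw⟩ := h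
    have h1 := koszulSign_mul_insert (Ne.symm hwv) hv hw
    simp only [smul_comm (X v : MvPolynomial σ K) (koszulSign w (insert v A)),
      smul_comm (X w : MvPolynomial σ K) (koszulSign v (insert w A)), smul_smul]
    rw [h1, Finset.insert_comm w v, mul_comm (X w : MvPolynomial σ K), neg_smul,
      neg_add_cancel]
  · rintro ⟨v, w⟩ h _ heq
    simp only [Finset.mem_sigma, Finset.mem_compl, Finset.mem_insert, not_or] at h
    exact h.2.1 (congrArg Sigma.fst heq)
  · rintro ⟨v, w⟩ h
    simp only [Finset.mem_sigma, Finset.mem_compl, Finset.mem_insert, not_or] at h ⊢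
    exact ⟨h.2.2, fun h' => h.2.1 h'.symm, h.1⟩
  · rintro ⟨v, w⟩ _
    rfl

/-- Naturality of the Koszul differential in the coefficients. -/
theorem koszulD_map {N : Type*} [AddCommGroup N] [Module (MvPolynomial σ K) N]
    (φ : M →ₗ[MvPolynomial σ K] N) (ω : Finset σ → M) :
    koszulD K (fun A => φ (ω A)) = fun A => φ (koszulD K ω A) := by
  funext A
  simp [koszulD_apply, map_sum]

theorem koszulD_mem {N : Submodule (MvPolynomial σ K) M} {ω : Finset σ → M}
    (h : ∀ A, ω A ∈ N) (A : Finset σ) : koszulD K ω A ∈ N := by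
  rw [koszulD_apply]
  exact N.sum_mem fun v _ => N.toAddSubgroup.zsmul_mem (N.smul_mem _ (h _)) _

/-- Exterior multiplication by `e_v`. -/
noncomputable def koszulWedge (v : σ) (ω : Finset σ → M) : Finset σ → M :=
  fun A => if v ∈ A then koszulSign v (A.erase v) • ω (A.erase v) else 0

/-- Exterior multiplication by `e_v` is a homotopy from multiplication by `x_v` to zero: this is
why `x_v` annihilates Koszul homology. -/
theorem koszulD_wedge_add (v : σ) (ω : Finset σ → M) :
    koszulD K (koszulWedge v ω) + koszulWedge v (koszulD K ω) =
      (X v : MvPolynomial σ K) • ω := by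
  funext B
  rw [Pi.add_apply, Pi.smul_apply, koszulD_apply]
  by_cases hv : v ∈ B
  · obtain ⟨A, hvA, rfl⟩ : ∃ A, v ∉ A ∧ B = insert v A :=
      ⟨B.erase v, by simp, (Finset.insert_erase hv).symm⟩
    have h2 : koszulWedge v (koszulD K ω) (insert v A) =
        koszulSign v A • koszulD K ω A := by
      simp [koszulWedge, hvA]
    have h3 : Aᶜ = insert v (insert v A)ᶜ := by
      ext x
      by_cases hx : x = v <;> simp_all
    rw [h2, koszulD_apply, h3, Finset.sum_insert (by simp), smul_add, smul_smul,
      koszulSign_mul_self, one_smul, add_left_comm, Finset.smul_sum, ← Finset.sum_add_distrib]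
    convert add_zero _
    refine Finset.sum_eq_zero fun w hw => ?_
    simp only [Finset.mem_compl, Finset.mem_insert, not_or] at hw
    have h4 : (insert w (insert v A)).erase v = insert w A := by
      rw [Finset.erase_insert_of_ne hw.1, Finset.erase_insert hvA]
    have h5 : koszulWedge v ω (insert w (insert v A)) =
        koszulSign v (insert w A) • ω (insert w A) := by
      rw [koszulWedge, if_pos (by simp), h4]
    have h6 := koszulSign_mul_insert (A := A) (Ne.symm hw.1) hvA hw.2
    have h7 : koszulSign w (insert v A) * koszulSign v (insert w A) =
        -(koszulSign v A * koszulSign w A) := by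
      linear_combination koszulSign v A * koszulSign v (insert w A) * h6 -
        koszulSign w (insert v A) * koszulSign v (insert w A) * koszulSign_mul_self v A -
        koszulSign v A * koszulSign w A * koszulSign_mul_self v (insert w A)
    rw [h5, smul_comm (X w : MvPolynomial σ K) (koszulSign v (insert w A)), smul_smul, h7,
      smul_smul, neg_smul, neg_add_cancel]
  · have h2 : koszulWedge v (koszulD K ω) B = 0 := if_neg hv
    rw [h2, add_zero, Finset.sum_eq_single v]
    · have h3 : koszulWedge v ω (insert v B) = koszulSign v B • ω B := by
        simp [koszulWedge, hv]
      rw [h3, smul_comm (X v : MvPolynomial σ K) (koszulSign v B), smul_smul,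
        koszulSign_mul_self, one_smul]
    · intro w _ hwv
      have : koszulWedge v ω (insert w B) = 0 :=
        if_neg (by simp [hv, Ne.symm hwv])
      simp [this]
    · simp [hv]

/-- The Koszul chains of homological degree `i` with coefficients in `𝓜 c`. Their total degree is
`i + c`. -/
def koszulChain (σ : Type*) {M : Type*} [AddCommGroup M] (𝓜 : ℤ → AddSubgroup M) (i : ℕ) (c : ℤ) :
    AddSubgroup (Finset σ → M) where
  carrier := {ω | ∀ A, ω A ∈ 𝓜 c ∧ (A.card ≠ i → ω A = 0)}
  zero_mem' := fun A => ⟨(𝓜 c).zero_mem, fun _ => rfl⟩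
  add_mem' := fun {a b} ha hb A => ⟨(𝓜 c).add_mem (ha A).1 (hb A).1, fun h => by
    simp [(ha A).2 h, (hb A).2 h]⟩
  neg_mem' := fun {a} ha A => ⟨(𝓜 c).neg_mem (ha A).1, fun h => by simp [(ha A).2 h]⟩

/-- The grading `𝓜` is compatible with the action of the variables. -/
def VarGraded (𝓜 : ℤ → AddSubgroup M) : Prop :=
  ∀ (v : σ) (c : ℤ), ∀ f ∈ 𝓜 c, (X v : MvPolynomial σ K) • f ∈ 𝓜 (c + 1)

variable {K}

theorem koszulD_mem_chain {𝓜 : ℤ → AddSubgroup M} (h𝓜 : VarGraded K (σ := σ) 𝓜) {i : ℕ} {c : ℤ}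
    {ω : Finset σ → M} (hω : ω ∈ koszulChain σ 𝓜 (i + 1) c) :
    koszulD K ω ∈ koszulChain σ 𝓜 i (c + 1) := by
  intro A
  rw [koszulD_apply]
  constructor
  · exact (𝓜 _).sum_mem fun v _ => (𝓜 _).zsmul_mem (h𝓜 _ _ _ (hω _).1) _
  · intro hA
    refine Finset.sum_eq_zero fun v hv => ?_
    rw [(hω _).2, smul_zero, smul_zero]
    rw [Finset.card_insert_of_notMem (by simpa using hv)]
    omega

theorem koszulD_eq_zero_of_mem_chain_zero {𝓜 : ℤ → AddSubgroup M} {c : ℤ}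
    {ω : Finset σ → M} (hω : ω ∈ koszulChain σ 𝓜 0 c) : koszulD K ω = 0 := by
  funext A
  rw [koszulD_apply]
  refine Finset.sum_eq_zero fun v _ => ?_
  rw [(hω _).2 (by simp), smul_zero, smul_zero]

theorem koszulWedge_mem_chain {𝓜 : ℤ → AddSubgroup M} {i : ℕ} {c : ℤ} (v : σ)
    {ω : Finset σ → M} (hω : ω ∈ koszulChain σ 𝓜 i c) :
    koszulWedge v ω ∈ koszulChain σ 𝓜 (i + 1) c := by
  intro A
  unfold koszulWedge
  split_ifs with h
  · refine ⟨(𝓜 _).zsmul_mem (hω _).1 _, fun hA => ?_⟩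
    rw [(hω _).2, smul_zero]
    rw [Finset.card_erase_of_mem h]
    have := Finset.card_pos.2 ⟨v, h⟩
    omega
  · exact ⟨(𝓜 _).zero_mem, fun _ => rfl⟩

theorem koszulWedge_mem {N : Submodule (MvPolynomial σ K) M} (v : σ) {ω : Finset σ → M}
    (h : ∀ A, ω A ∈ N) (A : Finset σ) : koszulWedge v ω A ∈ N := by
  unfold koszulWedge
  split_ifs
  · exact N.toAddSubgroup.zsmul_mem (h _) _
  · exact N.zero_mem

/-- The Koszul homology of the subquotient `P / N` of `M` vanishes in homological degree `i` and
coefficient degree `c`, that is, in total degree `i + c`. -/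
def KoszulVanishes (𝓜 : ℤ → AddSubgroup M) (P N : Submodule (MvPolynomial σ K) M)
    (i : ℕ) (c : ℤ) : Prop :=
  ∀ ω ∈ koszulChain σ 𝓜 i c, (∀ A, ω A ∈ P) → (∀ A, koszulD K ω A ∈ N) →
    ∃ η ∈ koszulChain σ 𝓜 (i + 1) (c - 1), (∀ A, η A ∈ P) ∧ ∀ A, ω A - koszulD K η A ∈ N

end Koszul

/-! ### Koszul homology of cyclic modules -/

section Cyclic

variable {σ K : Type*} [Field K]

/-- The forms of degree `c`, for an integer `c`; zero if `c` is negative. -/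
noncomputable def formsOfDegree (σ K : Type*) [Field K] (c : ℤ) :
    AddSubgroup (MvPolynomial σ K) :=
  if 0 ≤ c then (homogeneousSubmodule σ K c.toNat).toAddSubgroup else ⊥

/-- The homogeneous component of degree `c`, for an integer `c`. -/
noncomputable def formComponent (c : ℤ) : MvPolynomial σ K →ₗ[K] MvPolynomial σ K :=
  if 0 ≤ c then homogeneousComponent c.toNat else 0

theorem formComponent_mem (c : ℤ) (f : MvPolynomial σ K) :
    formComponent c f ∈ formsOfDegree σ K c := by
  unfold formComponent formsOfDegree
  split_ifs
  · exact homogeneousComponent_isHomogeneous _ _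
  · exact rfl

theorem formComponent_of_mem {c : ℤ} {f : MvPolynomial σ K} (hf : f ∈ formsOfDegree σ K c) :
    formComponent c f = f := by
  unfold formsOfDegree at hf
  unfold formComponent
  split_ifs with h
  · rw [if_pos h] at hf
    exact (homogeneousComponent_of_mem (n := c.toNat) hf).trans (if_pos rfl)
  · rw [if_neg h] at hf
    exact (AddSubgroup.mem_bot.1 hf).symm

theorem mem_formsOfDegree_natCast {k : ℕ} {f : MvPolynomial σ K} :
    f ∈ formsOfDegree σ K k ↔ f.IsHomogeneous k := by
  unfold formsOfDegree
  rw [if_pos (by omega)]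
  exact Iff.rfl

theorem eq_zero_of_mem_formsOfDegree {c : ℤ} (hc : c < 0) {f : MvPolynomial σ K}
    (hf : f ∈ formsOfDegree σ K c) : f = 0 := by
  unfold formsOfDegree at hf
  rwa [if_neg (by omega)] at hf

theorem formComponent_X_mul (c : ℤ) (v : σ) (f : MvPolynomial σ K) :
    formComponent c (X v * f) = X v * formComponent (c - 1) f := by
  unfold formComponent
  by_cases h : 0 ≤ c
  · rw [if_pos h, mul_comm, homogeneousComponent_mul_of_isHomogeneous f (isHomogeneous_X K v)]
    by_cases h1 : 0 ≤ c - 1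
    · rw [if_pos h1, if_pos (by omega), mul_comm]
      congr 3
      omega
    · rw [if_neg h1, if_neg (by omega)]
      simp
  · rw [if_neg h, if_neg (by omega)]
    simp

theorem X_mul_mem_formsOfDegree (v : σ) {c : ℤ} {f : MvPolynomial σ K}
    (hf : f ∈ formsOfDegree σ K c) : X v * f ∈ formsOfDegree σ K (c + 1) := by
  have h := formComponent_mem (c + 1) (X v * f)
  rwa [formComponent_X_mul, add_sub_cancel_right, formComponent_of_mem hf] at h

theorem varGraded_formsOfDegree : VarGraded (σ := σ) K (formsOfDegree σ K) :=
  fun v _ _ hf => X_mul_mem_formsOfDegree v hf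

/-- An ideal that contains the homogeneous components of its elements. -/
def IsGradedIdeal (I : Ideal (MvPolynomial σ K)) : Prop :=
  ∀ f ∈ I, ∀ d, homogeneousComponent d f ∈ I

theorem isGradedIdeal_span {s : Set (MvPolynomial σ K)} (hs : ∀ f ∈ s, ∃ d, f.IsHomogeneous d) :
    IsGradedIdeal (Ideal.span s) := by
  let _ : GradedAlgebra (homogeneousSubmodule σ K) := gradedAlgebra
  intro f hf d
  exact homogeneousComponent_mem_of_mem (Ideal.homogeneous_span _ _ hs) hf d

theorem IsGradedIdeal.exists_eq_add_X_mul {I : Ideal (MvPolynomial σ K)} (hI : IsGradedIdeal I)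
    {v : σ} {c : ℤ} {f : MvPolynomial σ K} (hf : f ∈ formsOfDegree σ K c)
    (hfI : f ∈ I ⊔ Ideal.span {X v}) :
    ∃ a ∈ formsOfDegree σ K c, ∃ b ∈ formsOfDegree σ K (c - 1), a ∈ I ∧ f = a + X v * b := by
  obtain ⟨a, ha, y, hy, rfl⟩ := Submodule.mem_sup.1 hfI
  obtain ⟨b, rfl⟩ := Ideal.mem_span_singleton'.1 hy
  refine ⟨formComponent c a, formComponent_mem _ _, formComponent (c - 1) b,
    formComponent_mem _ _, ?_, ?_⟩
  · unfold formComponent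
    split_ifs
    · exact hI a ha _
    · exact I.zero_mem
  · conv_lhs => rw [← formComponent_of_mem hf, mul_comm, map_add, formComponent_X_mul]

theorem IsGradedIdeal.exists_chain_eq_add_X_mul {I : Ideal (MvPolynomial σ K)}
    (hI : IsGradedIdeal I) {v : σ} {i : ℕ} {c : ℤ} {ω : Finset σ → MvPolynomial σ K}
    (hω : ω ∈ koszulChain σ (formsOfDegree σ K) i c) (hωI : ∀ A, ω A ∈ I ⊔ Ideal.span {X v}) :
    ∃ α ∈ koszulChain σ (formsOfDegree σ K) i c,
      ∃ β ∈ koszulChain σ (formsOfDegree σ K) i (c - 1), (∀ A, α A ∈ I) ∧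
        ω = α + (X v : MvPolynomial σ K) • β := by
  classical
  choose a ha b hb haI hab using fun A => hI.exists_eq_add_X_mul (hω A).1 (hωI A)
  refine ⟨fun A => if A.card = i then a A else 0, fun A => ?_,
    fun A => if A.card = i then b A else 0, fun A => ?_, fun A => ?_, ?_⟩
  · dsimp only
    split_ifs with h
    · exact ⟨ha A, fun h' => absurd h h'⟩
    · exact ⟨AddSubgroup.zero_mem _, fun _ => rfl⟩
  · dsimp only
    split_ifs with h
    · exact ⟨hb A, fun h' => absurd h h'⟩
    · exact ⟨AddSubgroup.zero_mem _, fun _ => rfl⟩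
  · dsimp only
    split_ifs
    · exact haI A
    · exact I.zero_mem
  · funext A
    by_cases h : A.card = i
    · simp [h, hab A]
    · simp [h, (hω A).2 h]

theorem X_smul_mem_chain (v : σ) {i : ℕ} {c : ℤ} {ω : Finset σ → MvPolynomial σ K}
    (hω : ω ∈ koszulChain σ (formsOfDegree σ K) i (c - 1)) :
    (X v : MvPolynomial σ K) • ω ∈ koszulChain σ (formsOfDegree σ K) i c := by
  intro A
  refine ⟨?_, fun hA => by simp [(hω A).2 hA]⟩
  have := X_mul_mem_formsOfDegree v (hω A).1
  rwa [sub_add_cancel] at this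

variable [Fintype σ] [DecidableEq σ]

/-- The Koszul homology of `S / I` lives in homological degrees at most `p` and coefficient
degrees at most `r`; equivalently, `S / I` has projective dimension at most `p` and regularity at
most `r`. -/
def CyclicBound (I : Ideal (MvPolynomial σ K)) (p : ℕ) (r : ℤ) : Prop :=
  ∀ i c, (p < i ∨ r < c) → KoszulVanishes (formsOfDegree σ K) ⊤ I i c

theorem CyclicBound.mono {I : Ideal (MvPolynomial σ K)} {p p' : ℕ} {r r' : ℤ}
    (h : CyclicBound I p r) (hp : p ≤ p') (hr : r ≤ r') : CyclicBound I p' r' :=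
  fun i c hic => h i c (by omega)

/-- The long exact sequence of `0 → S/(I : x_v)(-1) → S/I → S/(I + x_v) → 0`: the middle term. -/
theorem CyclicBound.of_colon {I I' : Ideal (MvPolynomial σ K)} (hI : IsGradedIdeal I) (v : σ)
    (hcolon : ∀ f, X v * f ∈ I ↔ f ∈ I') {p : ℕ} {r : ℤ} (h' : CyclicBound I' p (r - 1))
    (h : CyclicBound (I ⊔ Ideal.span {X v}) p r) : CyclicBound I p r := by
  intro i c hic ω hω _ hdω
  obtain ⟨η, hη, -, hη'⟩ := h i c hic ω hω (fun _ => trivial)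
    fun A => Ideal.mem_sup_left (hdω A)
  have hdη : koszulD K η ∈ koszulChain σ (formsOfDegree σ K) i c := by
    have := koszulD_mem_chain varGraded_formsOfDegree hη
    rwa [sub_add_cancel] at this
  obtain ⟨α, -, β, hβ, hαI, hαβ⟩ := hI.exists_chain_eq_add_X_mul (AddSubgroup.sub_mem _ hω hdη) hη'
  have hdβ : ∀ A, koszulD K β A ∈ I' := by
    intro A
    rw [← hcolon]
    have e : (X v : MvPolynomial σ K) • koszulD K β = koszulD K ω - koszulD K α := by
      have := congrArg (koszulD K) hαβ
      rw [map_sub, koszulD_koszulD, sub_zero, map_add, map_smul] at this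
      rw [this, add_sub_cancel_left]
    have e' := congrFun e A
    change X v * koszulD K β A = _ at e'
    rw [e']
    exact I.sub_mem (hdω A) (koszulD_mem K hαI A)
  obtain ⟨γ, hγ, -, hγ'⟩ := h' i (c - 1) (by omega) β hβ (fun _ => trivial) hdβ
  refine ⟨η + (X v : MvPolynomial σ K) • γ, AddSubgroup.add_mem _ hη (X_smul_mem_chain v hγ),
    fun _ => trivial, fun A => ?_⟩
  have e : ω A - koszulD K (η + (X v : MvPolynomial σ K) • γ) A =
      α A + X v * (β A - koszulD K γ A) := by
    have := congrFun hαβ A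
    simp only [Pi.sub_apply, Pi.add_apply, Pi.smul_apply, smul_eq_mul] at this
    rw [map_add, map_smul, Pi.add_apply, Pi.smul_apply, smul_eq_mul]
    linear_combination this
  rw [e]
  exact I.add_mem (hαI A) ((hcolon _).2 (hγ' A))

/-- Passing from `S/(I + x_v)` to `S/I`, for `x_v` regular on `S/I`. As `x_v` annihilates Koszul
homology, the homology of `S/I` in degree `i` embeds into that of `S/(I + x_v)` in degree
`i + 1`. -/
theorem CyclicBound.of_sup_X {I : Ideal (MvPolynomial σ K)} (hI : IsGradedIdeal I) (v : σ)
    (hreg : ∀ f, X v * f ∈ I → f ∈ I) {p : ℕ} {r : ℤ}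
    (h : CyclicBound (I ⊔ Ideal.span {X v}) (p + 1) r) : CyclicBound I p r := by
  intro i c hic ω hω _ hdω
  have hX : (X v : MvPolynomial σ K) ∈ I ⊔ Ideal.span {X v} :=
    Ideal.mem_sup_right (Ideal.mem_span_singleton_self _)
  have hhom := koszulD_wedge_add K v ω
  have hwI : ∀ A, koszulWedge v (koszulD K ω) A ∈ I := koszulWedge_mem v hdω
  have hw := koszulWedge_mem_chain v hω
  obtain ⟨η, hη, -, hη'⟩ := h (i + 1) c (by omega) _ hw (fun _ => trivial) fun A => by
    rw [eq_sub_of_add_eq hhom]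
    exact Ideal.sub_mem _ (Ideal.mul_mem_right _ _ hX) (Ideal.mem_sup_left (hwI A))
  have hdη : koszulD K η ∈ koszulChain σ (formsOfDegree σ K) (i + 1) c := by
    have := koszulD_mem_chain varGraded_formsOfDegree hη
    rwa [sub_add_cancel] at this
  obtain ⟨α, -, β, hβ, hαI, hαβ⟩ := hI.exists_chain_eq_add_X_mul (AddSubgroup.sub_mem _ hw hdη) hη'
  refine ⟨β, hβ, fun _ => trivial, fun A => hreg _ ?_⟩
  have e : (X v : MvPolynomial σ K) • (ω - koszulD K β) =
      koszulD K α + koszulWedge v (koszulD K ω) := by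
    have := congrArg (koszulD K) hαβ
    rw [map_sub, koszulD_koszulD, sub_zero, map_add, map_smul] at this
    rw [smul_sub, ← hhom, this]
    abel
  have e' := congrFun e A
  change X v * (ω A - koszulD K β A) = _ at e'
  rw [e']
  exact I.add_mem (koszulD_mem K hαI A) (hwI A)

/-- The long exact sequence of `0 → S/I(-1) → S/I → S/(I + x_v) → 0`, for `x_v` regular on `S/I`:
the last term. -/
theorem CyclicBound.sup_X {I : Ideal (MvPolynomial σ K)} (hI : IsGradedIdeal I) (v : σ)
    (hreg : ∀ f, X v * f ∈ I → f ∈ I) {p : ℕ} {r : ℤ}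
    (h : CyclicBound I p r) : CyclicBound (I ⊔ Ideal.span {X v}) (p + 1) r := by
  intro i c hic ω hω _ hdω
  obtain ⟨γ, hγ, hγ'⟩ : ∃ γ ∈ koszulChain σ (formsOfDegree σ K) i (c - 1),
      ∀ A, koszulD K (ω - (X v : MvPolynomial σ K) • γ) A ∈ I := by
    obtain _ | i := i
    · refine ⟨0, AddSubgroup.zero_mem _, fun A => ?_⟩
      rw [smul_zero, sub_zero, koszulD_eq_zero_of_mem_chain_zero hω]
      exact I.zero_mem
    obtain ⟨α, -, β, hβ, hαI, hαβ⟩ :=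
      hI.exists_chain_eq_add_X_mul (koszulD_mem_chain varGraded_formsOfDegree hω) hdω
    rw [add_sub_cancel_right] at hβ
    have hdβ : ∀ A, koszulD K β A ∈ I := by
      intro A
      apply hreg
      have e : (X v : MvPolynomial σ K) • koszulD K β = - koszulD K α := by
        have := congrArg (koszulD K) hαβ
        rw [koszulD_koszulD, map_add, map_smul] at this
        exact (neg_eq_of_add_eq_zero_right this.symm).symm
      have e' := congrFun e A
      change X v * koszulD K β A = _ at e'
      rw [e']
      exact I.neg_mem (koszulD_mem K hαI A)
    obtain ⟨γ, hγ, -, hγ'⟩ := h i c (by omega) β hβ (fun _ => trivial) hdβ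
    refine ⟨γ, hγ, fun A => ?_⟩
    have e : koszulD K (ω - (X v : MvPolynomial σ K) • γ) A =
        α A + X v * (β A - koszulD K γ A) := by
      rw [map_sub, map_smul, hαβ]
      simp only [Pi.sub_apply, Pi.add_apply, Pi.smul_apply, smul_eq_mul]
      ring
    rw [e]
    exact I.add_mem (hαI A) (I.mul_mem_left _ (hγ' A))
  obtain ⟨η, hη, -, hη'⟩ := h i c (by omega) _
    (AddSubgroup.sub_mem _ hω (X_smul_mem_chain v hγ)) (fun _ => trivial) hγ'
  refine ⟨η, hη, fun _ => trivial, fun A => ?_⟩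
  have e : ω A - koszulD K η A =
      (ω - (X v : MvPolynomial σ K) • γ) A - koszulD K η A + X v * γ A := by
    simp only [Pi.sub_apply, Pi.smul_apply, smul_eq_mul]
    ring
  rw [e]
  exact Ideal.add_mem _ (Ideal.mem_sup_left (hη' A)) (Ideal.mem_sup_right
    (Ideal.mul_mem_right _ _ (Ideal.mem_span_singleton_self _)))

end Cyclic

section Variables

variable {σ K : Type*} [Field K]

theorem mul_divMonomial_single_of_notMem_vars {v : σ} {g : MvPolynomial σ K} (hg : v ∉ g.vars)
    (h : MvPolynomial σ K) :
    divMonomial (h * g) (Finsupp.single v 1) = divMonomial h (Finsupp.single v 1) * g := by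
  classical
  ext m
  rw [coeff_divMonomial, ← support_sum_monomial_coeff g, Finset.mul_sum, Finset.mul_sum,
    coeff_sum, coeff_sum]
  refine Finset.sum_congr rfl fun u hu => ?_
  have hu0 : u v = 0 := mem_support_notMem_vars_zero hu hg
  have hle : u ≤ Finsupp.single v 1 + m ↔ u ≤ m := by
    refine ⟨fun h w => ?_, fun h => h.trans le_add_self⟩
    by_cases hw : w = v
    · rw [hw, hu0]
      exact Nat.zero_le _
    · simpa [Finsupp.single_apply, Ne.symm hw] using h w
  rw [coeff_mul_monomial', coeff_mul_monomial']
  by_cases h1 : u ≤ m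
  · rw [if_pos (hle.2 h1), if_pos h1, coeff_divMonomial, add_tsub_assoc_of_le h1]
  · rw [if_neg (hle.not.2 h1), if_neg h1]

/-- A variable is regular modulo an ideal generated by polynomials in which it does not occur. -/
theorem mem_span_of_X_mul_mem {v : σ} {s : Set (MvPolynomial σ K)} (hs : ∀ g ∈ s, v ∉ g.vars)
    {f : MvPolynomial σ K} (hf : X v * f ∈ Ideal.span s) : f ∈ Ideal.span s := by
  have key : ∀ y ∈ Ideal.span s, ∀ a : MvPolynomial σ K,
      divMonomial (a * y) (Finsupp.single v 1) ∈ Ideal.span s := by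
    intro y hy
    induction hy using Submodule.span_induction with
    | mem x hx =>
      intro a
      rw [mul_divMonomial_single_of_notMem_vars (hs x hx)]
      exact Ideal.mul_mem_left _ _ (Ideal.subset_span hx)
    | zero => simp
    | add x y _ _ hx hy =>
      intro a
      rw [mul_add, add_divMonomial]
      exact Ideal.add_mem _ (hx a) (hy a)
    | smul b x _ hx =>
      intro a
      rw [smul_eq_mul, ← mul_assoc]
      exact hx _
  have := key _ hf 1
  rwa [one_mul, X_mul_divMonomial] at this

variable [Fintype σ] [DecidableEq σ]

theorem cyclicBound_span_range_X :
    CyclicBound (Ideal.span (X '' (Set.univ : Set σ)) : Ideal (MvPolynomial σ K))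
      (Fintype.card σ) 0 := by
  intro i c hic ω hω _ _
  refine ⟨0, AddSubgroup.zero_mem _, fun _ => trivial, fun A => ?_⟩
  rw [map_zero, Pi.zero_apply, sub_zero]
  -- there are no chains above the number of variables, and forms of positive degree vanish in the
  -- residue field
  rcases hic with hi | hc
  · rw [(hω A).2 (by have := A.card_le_univ; omega)]
    exact Ideal.zero_mem _
  · rw [mem_ideal_span_X_image]
    intro d hd
    by_contra hcon
    have hd0 : d = 0 := by
      ext i
      by_contra h
      exact hcon ⟨i, trivial, h⟩
    have h1 := (hω A).1
    lift c to ℕ using hc.le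
    rw [mem_formsOfDegree_natCast] at h1
    have h2 := h1 (mem_support_iff.1 hd)
    rw [hd0, map_zero] at h2
    omega

/-- The Koszul resolution of `S / (x_t : t ∈ T)`: descend from the residue field, removing one
variable at a time. -/
theorem cyclicBound_span_X (T : Finset σ) :
    CyclicBound (Ideal.span (X '' (T : Set σ)) : Ideal (MvPolynomial σ K)) T.card 0 := by
  induction hk : Tᶜ.card generalizing T with
  | zero =>
    rw [Finset.card_eq_zero, Finset.compl_eq_empty_iff] at hk
    rw [hk, Finset.coe_univ]
    exact cyclicBound_span_range_X
  | succ k ih =>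
    obtain ⟨v, hv⟩ : Tᶜ.Nonempty := Finset.card_pos.1 (by omega)
    have hvT : v ∉ T := Finset.mem_compl.1 hv
    have h := ih (insert v T) (by
      rw [Finset.compl_insert, Finset.card_erase_of_mem hv, hk, Nat.add_sub_cancel])
    rw [Finset.card_insert_of_notMem hvT, Finset.coe_insert, Set.image_insert_eq, Set.insert_eq,
      Set.union_comm, Ideal.span_union] at h
    refine CyclicBound.of_sup_X (isGradedIdeal_span ?_) v (fun f => mem_span_of_X_mul_mem ?_) h
    · rintro _ ⟨t, _, rfl⟩
      exact ⟨1, isHomogeneous_X K t⟩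
    · rintro _ ⟨t, ht, rfl⟩
      rw [vars_X, Finset.mem_singleton]
      rintro rfl
      exact hvT ht

/-- The Koszul complex of the variables resolves the residue field. -/
theorem cyclicBound_bot : CyclicBound (⊥ : Ideal (MvPolynomial σ K)) 0 0 := by
  simpa using cyclicBound_span_X (K := K) (∅ : Finset σ)

end Variables

/-! ### From Koszul homology to minimal resolutions -/

section Resolution

variable {σ K : Type*} [Field K]

/-- The homogeneous elements of degree `c` of the graded free module `⨁ₐ S(-deg a)`. -/
noncomputable def freeForms {s : ℕ} (e : Fin s → ℕ) (c : ℤ) :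
    AddSubgroup (Fin s → MvPolynomial σ K) :=
  AddSubgroup.pi Set.univ fun b => formsOfDegree σ K (c - e b)

theorem mem_freeForms {s : ℕ} {e : Fin s → ℕ} {c : ℤ} {v : Fin s → MvPolynomial σ K} :
    v ∈ freeForms e c ↔ ∀ b, v b ∈ formsOfDegree σ K (c - e b) := by
  simp [freeForms, AddSubgroup.mem_pi]

theorem varGraded_freeForms {s : ℕ} (e : Fin s → ℕ) :
    VarGraded (σ := σ) K (freeForms (σ := σ) (K := K) e) := by
  intro v c f hf
  rw [mem_freeForms] at hf ⊢
  intro b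
  rw [add_sub_right_comm]
  exact X_mul_mem_formsOfDegree v (hf b)

theorem mem_freeForms_natCast {s : ℕ} {e : Fin s → ℕ} {d : ℕ} {v : Fin s → MvPolynomial σ K} :
    v ∈ freeForms e d ↔ IsHomogeneousVector e d v := by
  rw [mem_freeForms]
  refine forall_congr' fun b => ?_
  by_cases h : e b ≤ d
  · rw [← Nat.cast_sub h, mem_formsOfDegree_natCast]
    refine ⟨fun hv => Or.inr ⟨_, Nat.sub_add_cancel h, hv⟩, ?_⟩
    rintro (h0 | ⟨k, hk, hh⟩)
    · rw [h0]
      exact isHomogeneous_zero _ _ _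
    · rwa [← hk, Nat.add_sub_cancel]
  · refine ⟨fun hv => Or.inl (eq_zero_of_mem_formsOfDegree (by omega) hv), ?_⟩
    rintro (h0 | ⟨k, hk, hh⟩)
    · rw [h0]
      exact AddSubgroup.zero_mem _
    · omega

theorem eq_zero_of_mem_freeForms {s : ℕ} {e : Fin s → ℕ} {c : ℤ} (hc : c < 0)
    {v : Fin s → MvPolynomial σ K} (hv : v ∈ freeForms e c) : v = 0 := by
  funext b
  exact eq_zero_of_mem_formsOfDegree (by omega) (mem_freeForms.1 hv b)

/-- The data that a graded map of degree zero provides: forms map to forms, and every form in the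
range is the image of a form of the same degree. -/
structure IsGradedMap {s : ℕ} (e : Fin s → ℕ) {L : Type*} [AddCommGroup L]
    [Module (MvPolynomial σ K) L] (𝓛 : ℤ → AddSubgroup L)
    (φ : (Fin s → MvPolynomial σ K) →ₗ[MvPolynomial σ K] L) : Prop where
  map_mem : ∀ c, ∀ v ∈ freeForms e c, φ v ∈ 𝓛 c
  exists_lift : ∀ c, ∀ y ∈ LinearMap.range φ, y ∈ 𝓛 c → ∃ v ∈ freeForms e c, φ v = y

variable [Fintype σ] [DecidableEq σ]

/-- Koszul cycles with coefficients in a graded free module are boundaries, except in homological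
degree `0`, where the coefficient has to lie in the maximal ideal. -/
theorem exists_koszulD_eq_of_mem_freeForms {s : ℕ} {e : Fin s → ℕ} {i : ℕ} {c : ℤ}
    {ω : Finset σ → Fin s → MvPolynomial σ K} (hω : ω ∈ koszulChain σ (freeForms e) i c)
    (hdω : koszulD K ω = 0)
    (h0 : i = 0 → ∀ b, ω ∅ b ∈ Ideal.span (Set.range (X : σ → MvPolynomial σ K))) :
    ∃ η ∈ koszulChain σ (freeForms (σ := σ) (K := K) e) (i + 1) (c - 1), koszulD K η = ω := by
  have hcoord : ∀ b, ∃ η ∈ koszulChain σ (formsOfDegree σ K) (i + 1) (c - e b - 1),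
      koszulD K η = fun A => ω A b := by
    intro b
    have hωb : (fun A => ω A b) ∈ koszulChain σ (formsOfDegree σ K) i (c - e b) :=
      fun A => ⟨mem_freeForms.1 (hω A).1 b, fun hA => congrFun ((hω A).2 hA) b⟩
    by_cases hic : 0 < i ∨ 0 < c - e b
    · obtain ⟨η, hη, -, hη'⟩ := cyclicBound_bot i (c - e b) hic _ hωb (fun _ => trivial) (by
        intro A
        have h := koszulD_map K (LinearMap.proj (R := MvPolynomial σ K)
          (φ := fun _ : Fin s => MvPolynomial σ K) b) ω
        rw [hdω] at h
        exact Ideal.mem_bot.2 (congrFun h A))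
      exact ⟨η, hη, funext fun A => (sub_eq_zero.1 (Ideal.mem_bot.1 (hη' A))).symm⟩
    · push Not at hic
      obtain rfl : i = 0 := by omega
      refine ⟨0, AddSubgroup.zero_mem _, ?_⟩
      rw [map_zero]
      funext A
      by_cases hA : A = ∅
      · have h1 := (hωb A).1
        have h2 := h0 rfl b
        rw [← hA] at h2
        rcases hic.2.lt_or_eq with hc | hc
        · exact (eq_zero_of_mem_formsOfDegree hc h1).symm
        · rw [hc] at h1
          -- a constant in the maximal ideal
          have h3 : (ω A b).IsHomogeneous 0 := mem_formsOfDegree_natCast.1 h1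
          rw [← Set.image_univ, mem_ideal_span_X_image] at h2
          by_contra hne
          obtain ⟨d, hd⟩ := support_nonempty.2 (Ne.symm hne)
          obtain ⟨v, -, hv⟩ := h2 d hd
          have h4 := h3 (mem_support_iff.1 hd)
          change Finsupp.weight (fun _ => 1) d = 0 at h4
          rw [← Finsupp.degree_eq_weight_one, Finsupp.degree_eq_zero_iff] at h4
          exact hv (by rw [h4]; rfl)
      · exact ((hωb A).2 (by simpa using hA)).symm
  choose η hη hη' using hcoord
  refine ⟨fun A b => η b A, fun A => ⟨?_, fun hA => ?_⟩, ?_⟩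
  · rw [mem_freeForms]
    intro b
    rw [sub_right_comm]
    exact (hη b A).1
  · funext b
    exact (hη b A).2 hA
  · funext A b
    have h := koszulD_map K (LinearMap.proj (R := MvPolynomial σ K)
      (φ := fun _ : Fin s => MvPolynomial σ K) b) (fun A b => η b A)
    exact (congrFun h A).symm.trans (congrFun (hη' b) A)

/-- Dimension shift along a free cover `F → range φ`. The Koszul homology of `F` vanishes in positive
homological degrees, and in degree `0` minimality makes `ker φ → F` zero on it. -/
theorem KoszulVanishes.ker_of_range {s : ℕ} {e : Fin s → ℕ} {L : Type*} [AddCommGroup L]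
    [Module (MvPolynomial σ K) L] {𝓛 : ℤ → AddSubgroup L}
    {φ : (Fin s → MvPolynomial σ K) →ₗ[MvPolynomial σ K] L} (hφ : IsGradedMap e 𝓛 φ)
    (hmin : ∀ v ∈ LinearMap.ker φ, ∀ b,
      v b ∈ Ideal.span (Set.range (X : σ → MvPolynomial σ K)))
    {i : ℕ} {c : ℤ} (h : KoszulVanishes 𝓛 (LinearMap.range φ) ⊥ (i + 1) c) :
    KoszulVanishes (freeForms e) (LinearMap.ker φ) ⊥ i (c + 1) := by
  intro ω hω hωφ hdω
  have hdω' : koszulD K ω = 0 := funext fun A => (Submodule.mem_bot _).1 (hdω A)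
  obtain ⟨η, hη, hηω⟩ := exists_koszulD_eq_of_mem_freeForms hω hdω' fun _ => hmin _ (hωφ _)
  rw [add_sub_cancel_right] at hη
  obtain ⟨ζ, hζ, hζφ, hζη⟩ := h (fun A => φ (η A))
    (fun A => ⟨hφ.map_mem _ _ (hη A).1, fun hA => by
      change φ (η A) = 0
      rw [(hη A).2 hA, map_zero]⟩)
    (fun A => ⟨_, rfl⟩) (fun A => by
      rw [koszulD_map, hηω]
      exact hωφ A)
  choose ξ hξ hξφ using fun A => hφ.exists_lift _ _ (hζφ A) (hζ A).1
  let ξ' : Finset σ → Fin s → MvPolynomial σ K := fun A => if A.card = i + 1 + 1 then ξ A else 0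
  have hξ' : ξ' ∈ koszulChain σ (freeForms e) (i + 1 + 1) (c - 1) := by
    intro A
    simp only [ξ']
    split_ifs with hA
    · exact ⟨hξ A, fun h => absurd hA h⟩
    · exact ⟨AddSubgroup.zero_mem _, fun _ => rfl⟩
  have hξφ' : (fun A => φ (ξ' A)) = ζ := by
    funext A
    simp only [ξ']
    split_ifs with hA
    · exact hξφ A
    · rw [map_zero, (hζ A).2 hA]
  have hdξ := koszulD_mem_chain (varGraded_freeForms e) hξ'
  rw [sub_add_cancel] at hdξ
  refine ⟨η - koszulD K ξ', ?_, fun A => ?_, fun A => ?_⟩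
  · rw [add_sub_cancel_right]
    exact AddSubgroup.sub_mem _ hη hdξ
  · rw [LinearMap.mem_ker, Pi.sub_apply, map_sub]
    have h1 := congrFun (koszulD_map K φ ξ') A
    rw [← h1, hξφ']
    exact (Submodule.mem_bot _).1 (hζη A)
  · rw [map_sub, koszulD_koszulD, sub_zero, hηω, sub_self]
    exact Submodule.zero_mem _

/-- If the Koszul homology of `range φ` vanishes in homological degree `0` and degree `c`, then a
minimal free cover of `range φ` has no generator of degree `c`. -/
theorem KoszulVanishes.degree_ne {s : ℕ} {e : Fin s → ℕ} {L : Type*} [AddCommGroup L]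
    [Module (MvPolynomial σ K) L] {𝓛 : ℤ → AddSubgroup L}
    {φ : (Fin s → MvPolynomial σ K) →ₗ[MvPolynomial σ K] L} (hφ : IsGradedMap e 𝓛 φ)
    (hmin : ∀ v ∈ LinearMap.ker φ, ∀ b,
      v b ∈ Ideal.span (Set.range (X : σ → MvPolynomial σ K)))
    {c : ℤ} (h : KoszulVanishes 𝓛 (LinearMap.range φ) ⊥ 0 c) (b : Fin s) : (e b : ℤ) ≠ c := by
  rintro rfl
  have hb : (Pi.single b 1 : Fin s → MvPolynomial σ K) ∈ freeForms e (e b) := by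
    rw [mem_freeForms]
    intro a
    by_cases hab : a = b
    · subst hab
      rw [Pi.single_eq_same, sub_self]
      exact mem_formsOfDegree_natCast.2 (isHomogeneous_one σ K)
    · rw [Pi.single_eq_of_ne hab]
      exact AddSubgroup.zero_mem _
  let ω : Finset σ → L := fun A => if A.card = 0 then φ (Pi.single b 1) else 0
  have hω : ω ∈ koszulChain σ 𝓛 0 (e b) := by
    intro A
    simp only [ω]
    split_ifs with hA
    · exact ⟨hφ.map_mem _ _ hb, fun h => absurd hA h⟩
    · exact ⟨AddSubgroup.zero_mem _, fun _ => rfl⟩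
  obtain ⟨η, -, hη, hη'⟩ := h ω hω
    (fun A => by
      simp only [ω]
      split_ifs
      · exact LinearMap.mem_range_self φ _
      · exact Submodule.zero_mem _)
    (fun A => by
      rw [koszulD_eq_zero_of_mem_chain_zero hω]
      exact Submodule.zero_mem _)
  choose ξ hξ using hη
  -- the generator `e_b` agrees modulo `ker φ` with a combination of multiples of the variables
  have h1 : φ (Pi.single b 1 - koszulD K ξ ∅) = 0 := by
    have h2 := (Submodule.mem_bot _).1 (hη' ∅)
    have h3 := congrFun (koszulD_map K φ ξ) ∅
    rw [map_sub, ← h3]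
    simpa [ω, hξ] using h2
  have h2 := hmin _ h1 b
  have h3 : koszulD K ξ ∅ b ∈ Ideal.span (Set.range (X : σ → MvPolynomial σ K)) := by
    rw [koszulD_apply, Finset.sum_apply]
    refine Ideal.sum_mem _ fun v _ => ?_
    exact zsmul_mem (Ideal.mul_mem_right (ξ (insert v ∅) b) _
      (Ideal.subset_span (Set.mem_range_self v))) _
  have h4 := Ideal.add_mem _ h2 h3
  rw [Pi.sub_apply, sub_add_cancel, Pi.single_eq_same, ← Set.image_univ,
    mem_ideal_span_X_image] at h4
  obtain ⟨v, -, hv⟩ := h4 0 (by simp)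
  exact hv rfl

/-- Dimension shift from `S / I` to `I`. -/
theorem KoszulVanishes.ideal_of_quotient {I : Ideal (MvPolynomial σ K)} {i : ℕ} {c : ℤ}
    (hic : 0 < i ∨ 0 < c) (h : KoszulVanishes (formsOfDegree σ K) ⊤ I (i + 1) (c - 1)) :
    KoszulVanishes (formsOfDegree σ K) I ⊥ i c := by
  intro ω hω hωI hdω
  obtain ⟨η, hη, -, hηω⟩ := cyclicBound_bot i c hic ω hω (fun _ => trivial) hdω
  have hηω' : koszulD K η = ω :=
    funext fun A => (sub_eq_zero.1 (Ideal.mem_bot.1 (hηω A))).symm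
  obtain ⟨ζ, hζ, -, hζη⟩ := h η hη (fun _ => trivial) fun A => by
    rw [hηω']
    exact hωI A
  have hdζ := koszulD_mem_chain varGraded_formsOfDegree hζ
  rw [sub_add_cancel] at hdζ
  refine ⟨η - koszulD K ζ, AddSubgroup.sub_mem _ hη hdζ, hζη, fun A => ?_⟩
  rw [map_sub, koszulD_koszulD, sub_zero, hηω', sub_self]
  exact Ideal.zero_mem _

end Resolution

section Invariants

variable {σ K : Type*} [Field K]

theorem vectorComponent_of_mem_freeForms {s : ℕ} {e : Fin s → ℕ} {d : ℕ}
    {v : Fin s → MvPolynomial σ K} (hv : v ∈ freeForms e d) : vectorComponent e d v = v := by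
  funext b
  have hb := mem_freeForms.1 hv b
  unfold vectorComponent
  split_ifs with h
  · rw [← Nat.cast_sub h, mem_formsOfDegree_natCast] at hb
    exact (homogeneousComponent_of_mem hb).trans (if_pos rfl)
  · exact (eq_zero_of_mem_formsOfDegree (by omega) hb).symm

theorem map_vectorComponent {s r : ℕ} {e : Fin s → ℕ} {deg : Fin r → ℕ}
    {φ : (Fin s → MvPolynomial σ K) →ₗ[MvPolynomial σ K] (Fin r → MvPolynomial σ K)}
    (hφ : ∀ b, IsHomogeneousVector deg (e b) (φ (Pi.single b 1))) (d : ℕ)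
    (v : Fin s → MvPolynomial σ K) :
    φ (vectorComponent e d v) = vectorComponent deg d (φ v) := by
  have key : ∀ w, φ w = ∑ b, w b • φ (Pi.single b 1) := fun w => by
    conv_lhs => rw [pi_eq_sum_univ' w, map_sum]
    refine Finset.sum_congr rfl fun b _ => ?_
    rw [map_smul]
  rw [key, key v, vectorComponent_sum]
  refine Finset.sum_congr rfl fun b _ => ?_
  rw [vectorComponent_smul deg d (e b) (v b) (hφ b)]
  rfl

theorem isGradedMap_of_isHomogeneousVector {s r : ℕ} {e : Fin s → ℕ} {deg : Fin r → ℕ}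
    {φ : (Fin s → MvPolynomial σ K) →ₗ[MvPolynomial σ K] (Fin r → MvPolynomial σ K)}
    (hφ : ∀ b, IsHomogeneousVector deg (e b) (φ (Pi.single b 1))) :
    IsGradedMap e (freeForms deg) φ := by
  constructor
  · intro c v hv
    rcases lt_or_ge c 0 with hc | hc
    · rw [eq_zero_of_mem_freeForms hc hv, map_zero]
      exact AddSubgroup.zero_mem _
    · lift c to ℕ using hc
      rw [← vectorComponent_of_mem_freeForms hv, map_vectorComponent hφ, mem_freeForms_natCast]
      exact isHomogeneousVector_vectorComponent _ _ _
  · rintro c _ ⟨v, rfl⟩ hy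
    rcases lt_or_ge c 0 with hc | hc
    · exact ⟨0, AddSubgroup.zero_mem _, by rw [eq_zero_of_mem_freeForms hc hy, map_zero]⟩
    · lift c to ℕ using hc
      exact ⟨vectorComponent e c v,
        mem_freeForms_natCast.2 (isHomogeneousVector_vectorComponent _ _ _),
        by rw [map_vectorComponent hφ, vectorComponent_of_mem_freeForms hy]⟩

theorem isGradedMap_of_isHomogeneous {s : ℕ} {e : Fin s → ℕ}
    {φ : (Fin s → MvPolynomial σ K) →ₗ[MvPolynomial σ K] MvPolynomial σ K}
    (hφ : ∀ b, (φ (Pi.single b 1)).IsHomogeneous (e b)) :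
    IsGradedMap e (formsOfDegree σ K) φ := by
  -- regard the target as the free module with one generator, in degree zero
  have h := isGradedMap_of_isHomogeneousVector (e := e) (deg := fun _ : Fin 1 => 0)
    (φ := LinearMap.pi fun _ => φ) fun b _ => Or.inr ⟨e b, rfl, hφ b⟩
  constructor
  · intro c v hv
    have := mem_freeForms.1 (h.map_mem c v hv) 0
    rwa [Nat.cast_zero, sub_zero] at this
  · rintro c _ ⟨v, rfl⟩ hy
    obtain ⟨w, hw, hwv⟩ := h.exists_lift c _ ⟨v, rfl⟩ (by
      rw [mem_freeForms]
      intro _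
      rwa [Nat.cast_zero, sub_zero])
    exact ⟨w, hw, congrFun hwv 0⟩

theorem gradedBetti_eq_zero_of_forall {I : Ideal (MvPolynomial σ K)} {i j : ℕ}
    (h : ∀ F : MinimalGradedFreeResolution I, ∀ b, F.deg i b ≠ j) : gradedBetti I i j = 0 := by
  unfold gradedBetti
  rw [ENat.iSup_eq_zero]
  intro F
  have : F.betti i j = 0 := by
    unfold MinimalGradedFreeResolution.betti
    rw [Finset.card_eq_zero, Finset.filter_eq_empty_iff]
    exact fun b _ => h F b
  rw [this, Nat.cast_zero]

variable [Fintype σ] [DecidableEq σ]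

/-- Dimension shift along a minimal resolution: vanishing of the Koszul homology of `I` in
homological degree `i` forbids generators of `F_i`. -/
theorem MinimalGradedFreeResolution.deg_ne {I : Ideal (MvPolynomial σ K)}
    (F : MinimalGradedFreeResolution I) (i : ℕ) (c : ℤ)
    (h : KoszulVanishes (formsOfDegree σ K) I ⊥ i c) (b : Fin (F.rank i)) :
    (F.deg i b : ℤ) ≠ c + i := by
  let φ : (Fin (F.rank 0) → MvPolynomial σ K) →ₗ[MvPolynomial σ K] MvPolynomial σ K :=
    I.subtype ∘ₗ F.aug
  have hker : LinearMap.ker φ = LinearMap.range (F.d 0) := by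
    rw [← LinearMap.exact_iff.1 F.exact_zero, LinearMap.ker_comp, Submodule.ker_subtype]
    rfl
  have hrange : LinearMap.range φ = I := by
    rw [LinearMap.range_comp, LinearMap.range_eq_top.2 F.aug_surjective, Submodule.map_top,
      Submodule.range_subtype]
  have hφ : IsGradedMap (F.deg 0) (formsOfDegree σ K) φ :=
    isGradedMap_of_isHomogeneous F.aug_homogeneous
  have hφmin : ∀ v ∈ LinearMap.ker φ, ∀ a,
      v a ∈ Ideal.span (Set.range (X : σ → MvPolynomial σ K)) := by
    rw [hker]
    rintro _ ⟨w, rfl⟩ a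
    exact F.minimal 0 w a
  have hd : ∀ k, IsGradedMap (F.deg (k + 1)) (freeForms (F.deg k)) (F.d k) :=
    fun k => isGradedMap_of_isHomogeneousVector (F.d_homogeneous k)
  have hdmin : ∀ k, ∀ v ∈ LinearMap.ker (F.d k), ∀ a,
      v a ∈ Ideal.span (Set.range (X : σ → MvPolynomial σ K)) := by
    intro k
    rw [LinearMap.exact_iff.1 (F.exact_succ k)]
    rintro _ ⟨w, rfl⟩ a
    exact F.minimal (k + 1) w a
  rw [← hrange] at h
  obtain _ | i := i
  · rw [Nat.cast_zero, add_zero]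
    exact h.degree_ne hφ hφmin b
  have hshift : ∀ k j, j + k = i →
      KoszulVanishes (freeForms (F.deg k)) (LinearMap.range (F.d k)) ⊥ j (c + k + 1) := by
    intro k
    induction k with
    | zero =>
      rintro j rfl
      rw [← hker, Nat.cast_zero, add_zero]
      exact h.ker_of_range hφ hφmin
    | succ k ih =>
      rintro j hj
      rw [← LinearMap.exact_iff.1 (F.exact_succ k)]
      have := (ih (j + 1) (by omega)).ker_of_range (hd k) (hdmin k)
      rwa [Nat.cast_succ, ← add_assoc]
  rw [Nat.cast_succ, ← add_assoc]
  exact (hshift i 0 (zero_add i)).degree_ne (hd i) (hdmin i) b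

theorem CyclicBound.gradedBetti_ne_zero {I : Ideal (MvPolynomial σ K)} {p : ℕ} {r : ℤ}
    (hr : 0 ≤ r) (h : CyclicBound I (p + 1) r) {i j : ℕ} (hij : gradedBetti I i j ≠ 0) :
    i ≤ p ∧ (j : ℤ) - i ≤ r + 1 := by
  by_contra hcon
  refine hij (gradedBetti_eq_zero_of_forall fun F b hb => ?_)
  refine F.deg_ne i (j - i) ?_ b (by rw [hb]; ring)
  exact KoszulVanishes.ideal_of_quotient (by omega) (h _ _ (by omega))

theorem CyclicBound.projDim_le {I : Ideal (MvPolynomial σ K)} {p : ℕ} {r : ℤ}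
    (hr : 0 ≤ r) (h : CyclicBound I (p + 1) r) : projDim I ≤ ((p : ℕ∞) : WithBot ℕ∞) := by
  refine iSup_le fun i => iSup_le fun j => iSup_le fun hij => ?_
  exact_mod_cast (h.gradedBetti_ne_zero hr hij).1

theorem CyclicBound.regularity_le {I : Ideal (MvPolynomial σ K)} {p : ℕ} {r : ℤ}
    (hr : 0 ≤ r) (h : CyclicBound I (p + 1) r) :
    regularity I ≤ (((r + 1 : ℤ) : WithTop ℤ) : WithBot (WithTop ℤ)) := by
  refine iSup_le fun i => iSup_le fun j => iSup_le fun hij => ?_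
  exact WithBot.coe_le_coe.2 (WithTop.coe_le_coe.2 (h.gradedBetti_ne_zero hr hij).2)

end Invariants

/-! ### Regular variables modulo pure difference binomial ideals -/

section Invariant

variable {σ K P : Type*} [Field K]

/-- The linear map that sends each monomial `x^u` to the basis vector of its invariant `π u`. -/
noncomputable def invariantMap (K : Type*) [Field K] (π : (σ →₀ ℕ) → P) :
    MvPolynomial σ K →ₗ[K] (P →₀ K) :=
  (basisMonomials σ K).constr K fun u => Finsupp.single (π u) 1

theorem invariantMap_monomial (π : (σ →₀ ℕ) → P) (u : σ →₀ ℕ) :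
    invariantMap K π (monomial u 1) = Finsupp.single (π u) 1 := by
  have h := (basisMonomials σ K).constr_basis K
    (fun u => (Finsupp.single (π u) 1 : P →₀ K)) u
  rwa [coe_basisMonomials] at h

theorem invariantMap_eq_zero_of_mem_span {π : (σ →₀ ℕ) → P} {s : Set (MvPolynomial σ K)}
    (hs : ∀ g ∈ s, ∃ a b, g = monomial a 1 - monomial b 1 ∧ ∀ t, π (t + a) = π (t + b))
    {f : MvPolynomial σ K} (hf : f ∈ Ideal.span s) : invariantMap K π f = 0 := by
  have key : ∀ y ∈ Ideal.span s, ∀ q : MvPolynomial σ K, invariantMap K π (q * y) = 0 := by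
    intro y hy
    induction hy using Submodule.span_induction with
    | mem x hx =>
      obtain ⟨a, b, rfl, hab⟩ := hs x hx
      intro q
      induction q using MvPolynomial.induction_on' with
      | monomial t r =>
        have e : monomial t r * (monomial a 1 - monomial b 1 : MvPolynomial σ K) =
            r • (monomial (t + a) 1 - monomial (t + b) 1) := by
          rw [mul_sub, monomial_mul, monomial_mul, smul_sub, smul_monomial, smul_monomial]
          simp
        rw [e, map_smul, map_sub, invariantMap_monomial, invariantMap_monomial, hab, sub_self,
          smul_zero]
      | add p q hp hq => rw [add_mul, map_add, hp, hq, add_zero]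
    | zero => simp
    | add x y _ _ hx hy =>
      intro q
      rw [mul_add, map_add, hx, hy, add_zero]
    | smul b x _ hx =>
      intro q
      rw [smul_eq_mul, ← mul_assoc]
      exact hx _
  have := key f hf 1
  rwa [one_mul] at this

/-- An ideal spanned by differences of monomials with the same invariant `π`, containing all such
differences, is the kernel of `invariantMap`. A variable `x_v` is regular modulo it as soon as
`π (x_v u)` determines `π u`. -/
theorem mem_span_of_X_mul_mem_of_invariant {π : (σ →₀ ℕ) → P} {s : Set (MvPolynomial σ K)}
    (hs : ∀ g ∈ s, ∃ a b, g = monomial a 1 - monomial b 1 ∧ ∀ t, π (t + a) = π (t + b))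
    (hπ : ∀ u u', π u = π u' → (monomial u 1 - monomial u' 1 : MvPolynomial σ K) ∈ Ideal.span s)
    {v : σ} (hv : ∀ u u', π (Finsupp.single v 1 + u) = π (Finsupp.single v 1 + u') → π u = π u')
    {f : MvPolynomial σ K} (hf : X v * f ∈ Ideal.span s) : f ∈ Ideal.span s := by
  have h0 := invariantMap_eq_zero_of_mem_span hs hf
  -- `lift` sends the invariant of `x_v u` back to some monomial with the same invariant as `u`
  let lift : P → σ →₀ ℕ := Function.invFun fun u => π (Finsupp.single v 1 + u)
  have hlift : ∀ u, π (lift (π (Finsupp.single v 1 + u))) = π u := fun u =>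
    hv _ _ (Function.invFun_eq (f := fun u => π (Finsupp.single v 1 + u)) ⟨u, rfl⟩)
  have key : ∀ g : MvPolynomial σ K, Finsupp.linearCombination K
      (fun p => (monomial (lift p) 1 : MvPolynomial σ K)) (invariantMap K π (X v * g)) - g ∈
        Ideal.span s := by
    intro g
    induction g using MvPolynomial.induction_on' with
    | monomial t r =>
      have e : X v * monomial t r =
          r • (monomial (Finsupp.single v 1 + t) 1 : MvPolynomial σ K) := by
        rw [X, monomial_mul, smul_monomial]
        simp
      have e' : monomial t r = r • (monomial t 1 : MvPolynomial σ K) := by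
        rw [smul_monomial]
        simp
      rw [e, map_smul, map_smul, invariantMap_monomial, Finsupp.linearCombination_single, one_smul,
        e', ← smul_sub]
      exact Submodule.smul_of_tower_mem _ r (hπ _ _ (hlift t))
    | add p q hp hq =>
      rw [mul_add, map_add, map_add, add_sub_add_comm]
      exact Ideal.add_mem _ hp hq
  have := key f
  rw [h0, map_zero, zero_sub] at this
  exact neg_mem_iff.1 this

end Invariant

/-! ### Binomial edge ideals with additional variables -/

section EdgeIdeal

variable {V : Type*}

/-- The generator `x_i y_j - x_j y_i` of a binomial edge ideal. -/
noncomputable def edgeBinomial (K : Type*) [Field K] (i j : V) : MvPolynomial (V ⊕ V) K :=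
  X (Sum.inl i) * X (Sum.inr j) - X (Sum.inl j) * X (Sum.inr i)

/-- The ideal generated by the variables `x_a` with `a ∈ A` and `y_b` with `b ∈ B`, and by the
binomials `x_i y_j - x_j y_i` with `E i j`. The relation `E` need not be irreflexive: the binomial
of a loop is zero. -/
noncomputable def edgeIdeal (K : Type*) [Field K] (A B : Finset V) (E : V → V → Prop) :
    Ideal (MvPolynomial (V ⊕ V) K) :=
  Ideal.span (X '' (A.disjSum B : Set (V ⊕ V)) ∪ {f | ∃ i j, E i j ∧ f = edgeBinomial K i j})

/-- The edges of the complete graph on `U` together with a vertex `w` joined to the vertices in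
`C`. -/
def coneRel (U C : Finset V) (w : V) (i j : V) : Prop :=
  (i ∈ U ∧ j ∈ U) ∨ (i = w ∧ j ∈ C) ∨ (j = w ∧ i ∈ C)

variable {K : Type*} [Field K]

theorem edgeBinomial_mem {A B : Finset V} {E : V → V → Prop} {i j : V} (h : E i j) :
    edgeBinomial K i j ∈ edgeIdeal K A B E :=
  Ideal.subset_span (Or.inr ⟨i, j, h, rfl⟩)

theorem X_inl_mem_edgeIdeal {A B : Finset V} {E : V → V → Prop} {v : V} (h : v ∈ A) :
    X (Sum.inl v) ∈ edgeIdeal K A B E :=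
  Ideal.subset_span (Or.inl ⟨_, by simpa using h, rfl⟩)

theorem X_inr_mem_edgeIdeal {A B : Finset V} {E : V → V → Prop} {v : V} (h : v ∈ B) :
    X (Sum.inr v) ∈ edgeIdeal K A B E :=
  Ideal.subset_span (Or.inl ⟨_, by simpa using h, rfl⟩)

theorem edgeBinomial_eq (i j : V) : edgeBinomial K i j =
    monomial (Finsupp.single (Sum.inl i) 1 + Finsupp.single (Sum.inr j) 1) 1 -
      monomial (Finsupp.single (Sum.inl j) 1 + Finsupp.single (Sum.inr i) 1) 1 := by
  simp [edgeBinomial, X, monomial_mul]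

variable [Fintype V] [DecidableEq V]

/-- The invariant of a monomial modulo the ideal of `coneRel U C w`: the degrees in the pairs
`{x_i, y_i}`, the exponents of the `y_i` for isolated vertices `i`, the total degree in the `y_i`
and, for monomials that avoid the common neighbours `C`, the exponent of `y_w`. -/
def coneInvariant (U C : Finset V) (w : V) (u : V ⊕ V →₀ ℕ) :
    (V → ℕ) × (V → ℕ) × ℕ × ℕ :=
  (fun i => u (Sum.inl i) + u (Sum.inr i), fun i => if i ∈ U ∨ i = w then 0 else u (Sum.inr i),
    ∑ i, u (Sum.inr i), if ∀ c ∈ C, u (Sum.inl c) + u (Sum.inr c) = 0 then u (Sum.inr w) else 0)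

theorem coneInvariant_add_edge {U C : Finset V} {w i j : V} (hCU : C ⊆ U) (hw : w ∉ U)
    (h : coneRel U C w i j) (t : V ⊕ V →₀ ℕ) :
    coneInvariant U C w (t + (Finsupp.single (Sum.inl i) 1 + Finsupp.single (Sum.inr j) 1)) =
      coneInvariant U C w
        (t + (Finsupp.single (Sum.inl j) 1 + Finsupp.single (Sum.inr i) 1)) := by
  have hdeg : ∀ a b k : V,
      (t + (Finsupp.single (Sum.inl a) 1 + Finsupp.single (Sum.inr b) 1) : V ⊕ V →₀ ℕ) (Sum.inl k) +
        (t + (Finsupp.single (Sum.inl a) 1 + Finsupp.single (Sum.inr b) 1) : V ⊕ V →₀ ℕ) (Sum.inr k) =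
      t (Sum.inl k) + t (Sum.inr k) + (if a = k then 1 else 0) + (if b = k then 1 else 0) := by
    intro a b k
    simp [Finsupp.single_apply]
    ring
  have hy : ∀ a b k : V, b ≠ k →
      (t + (Finsupp.single (Sum.inl a) 1 + Finsupp.single (Sum.inr b) 1) : V ⊕ V →₀ ℕ) (Sum.inr k) =
        t (Sum.inr k) := by
    intro a b k hbk
    simp [hbk]
  have hC : ∀ k ∈ C, k ∈ U := fun k hk => hCU hk
  unfold coneInvariant
  simp only [hdeg]
  refine Prod.ext (funext fun k => add_right_comm _ _ _) (Prod.ext (funext fun k => ?_)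
    (Prod.ext ?_ ?_)) <;> dsimp only
  · split_ifs with hk
    · rfl
    · rw [hy _ _ _ ?_, hy _ _ _ ?_] <;>
      · rintro rfl
        unfold coneRel at h
        grind
  · simp [Finset.sum_add_distrib, Finsupp.single_apply]
  · simp only [add_right_comm _ (if j = _ then 1 else 0) (if i = _ then 1 else 0)]
    split_ifs with h0
    · have hjC : j ∉ C := fun hj => by simpa using h0 j hj
      have hiC : i ∉ C := fun hi => by simpa using h0 i hi
      rw [hy _ _ _ ?_, hy _ _ _ ?_] <;>
      · rintro rfl
        unfold coneRel at h
        grind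
    · rfl

theorem coneInvariant_X_cancel {U C : Finset V} {w : V} {u u' : V ⊕ V →₀ ℕ} (hwC : w ∉ C)
    (h : coneInvariant U C w (Finsupp.single (Sum.inl w) 1 + u) =
      coneInvariant U C w (Finsupp.single (Sum.inl w) 1 + u')) :
    coneInvariant U C w u = coneInvariant U C w u' := by
  have hy : ∀ (t : V ⊕ V →₀ ℕ) k, (Finsupp.single (Sum.inl w) 1 + t : V ⊕ V →₀ ℕ) (Sum.inr k) =
      t (Sum.inr k) := by
    intro t k
    simp
  have hdeg : ∀ (t : V ⊕ V →₀ ℕ) k, (Finsupp.single (Sum.inl w) 1 + t : V ⊕ V →₀ ℕ) (Sum.inl k) =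
      (if w = k then 1 else 0) + t (Sum.inl k) := by
    intro t k
    simp [Finsupp.single_apply]
  have hcond : ∀ t : V ⊕ V →₀ ℕ, (∀ c ∈ C, (if w = c then 1 else 0) + t (Sum.inl c) +
      t (Sum.inr c) = 0) ↔ ∀ c ∈ C, t (Sum.inl c) + t (Sum.inr c) = 0 := by
    refine fun t => forall₂_congr fun c hc => ?_
    rw [if_neg (by rintro rfl; exact hwC hc), zero_add]
  unfold coneInvariant at h ⊢
  simp only [hy, hdeg, hcond, Prod.mk.injEq] at h ⊢
  refine ⟨funext fun k => ?_, h.2⟩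
  have := congrFun h.1 k
  omega

theorem coneRel_generators {U C : Finset V} {w : V} (hCU : C ⊆ U) (hw : w ∉ U) :
    ∀ g ∈ (X '' (((∅ : Finset V).disjSum ∅ : Finset (V ⊕ V)) : Set (V ⊕ V)) ∪
      {f | ∃ i j, coneRel U C w i j ∧ f = edgeBinomial K i j}),
      ∃ a b, g = monomial a 1 - monomial b 1 ∧
        ∀ t, coneInvariant U C w (t + a) = coneInvariant U C w (t + b) := by
  rintro g (⟨_, h, _⟩ | ⟨i, j, h, rfl⟩)
  · simp at h
  · exact ⟨_, _, edgeBinomial_eq i j, coneInvariant_add_edge hCU hw h⟩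

/-- Two monomials with the same invariant are joined by exchanges `x_j y_i ↦ x_i y_j`. If `i` and
`j` are not adjacent, then one of them is `w`, and the exchange is carried out through a common
neighbour `c` whose variable divides the monomial. -/
theorem monomial_sub_mem_of_coneInvariant_eq {U C : Finset V} {w : V} (hCU : C ⊆ U) (hw : w ∉ U)
    {u v : V ⊕ V →₀ ℕ} (h : coneInvariant U C w u = coneInvariant U C w v) :
    (monomial u 1 - monomial v 1 : MvPolynomial (V ⊕ V) K) ∈ edgeIdeal K ∅ ∅ (coneRel U C w) := by
  induction hN : ∑ i, (u (Sum.inr i) - v (Sum.inr i)) using Nat.strong_induction_on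
    generalizing u with
  | _ N ih =>
  subst hN
  have hdeg : ∀ i, u (Sum.inl i) + u (Sum.inr i) = v (Sum.inl i) + v (Sum.inr i) :=
    fun i => congrFun (congrArg Prod.fst h) i
  have hiso : ∀ i, ¬(i ∈ U ∨ i = w) → u (Sum.inr i) = v (Sum.inr i) := by
    intro i hi
    have := congrFun (congrArg (fun p => p.2.1) h) i
    simpa only [coneInvariant, if_neg hi] using this
  have hsum : ∑ i, u (Sum.inr i) = ∑ i, v (Sum.inr i) := congrArg (fun p => p.2.2.1) h
  have hC : (∀ c ∈ C, u (Sum.inl c) + u (Sum.inr c) = 0) → u (Sum.inr w) = v (Sum.inr w) := by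
    intro h0
    have := congrArg (fun p => p.2.2.2) h
    have h0' : ∀ c ∈ C, v (Sum.inl c) + v (Sum.inr c) = 0 := fun c hc => by
      rw [← hdeg]
      exact h0 c hc
    simpa only [coneInvariant, if_pos h0, if_pos h0'] using this
  by_cases hle : ∀ i, u (Sum.inr i) ≤ v (Sum.inr i)
  · have heq : ∀ i, u (Sum.inr i) = v (Sum.inr i) := fun i =>
      (Finset.sum_eq_sum_iff_of_le fun i _ => hle i).1 hsum i (Finset.mem_univ i)
    have : u = v := by
      ext (i | i)
      · have := hdeg i
        have := heq i
        omega
      · exact heq i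
    rw [this, sub_self]
    exact Ideal.zero_mem _
  push Not at hle
  obtain ⟨i, hi⟩ := hle
  obtain ⟨j, hj⟩ : ∃ j, u (Sum.inr j) < v (Sum.inr j) := by
    by_contra hcon
    push Not at hcon
    exact (Finset.sum_lt_sum (fun k _ => hcon k) ⟨i, Finset.mem_univ i, hi⟩).ne' hsum
  have hij : i ≠ j := by
    rintro rfl
    omega
  have hiU : i ∈ U ∨ i = w := by
    by_contra hcon
    exact hi.ne' (hiso i hcon)
  have hjU : j ∈ U ∨ j = w := by
    by_contra hcon
    exact hj.ne (hiso j hcon)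
  obtain ⟨t, rfl⟩ : ∃ t, u = t + (Finsupp.single (Sum.inl j) 1 + Finsupp.single (Sum.inr i) 1) := by
    refine ⟨u - (Finsupp.single (Sum.inl j) 1 + Finsupp.single (Sum.inr i) 1),
      (tsub_add_cancel_of_le fun k => ?_).symm⟩
    have := hdeg j
    obtain k | k := k
    · by_cases hk : k = j
      · subst hk
        simp
        omega
      · simp [Ne.symm hk]
    · by_cases hk : k = i
      · subst hk
        simp
        omega
      · simp [Ne.symm hk]
  have hgen : monomial t 1 * edgeBinomial K i j ∈ edgeIdeal K ∅ ∅ (coneRel U C w) := by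
    by_cases hE : coneRel U C w i j
    · exact Ideal.mul_mem_left _ _ (edgeBinomial_mem hE)
    have hEw : i = w ∨ j = w := by
      unfold coneRel at hE
      tauto
    obtain ⟨c, hc, hc0⟩ : ∃ c ∈ C, t (Sum.inl c) ≠ 0 ∨ t (Sum.inr c) ≠ 0 := by
      by_contra hcon
      push Not at hcon
      have h1 := hC fun c hc => by
        have hci : i ≠ c := by
          rintro rfl
          unfold coneRel at hE
          have := hCU hc
          grind
        have hcj : j ≠ c := by
          rintro rfl
          unfold coneRel at hE
          have := hCU hc
          grind
        simp [hcon c hc, hci, hcj]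
      rcases hEw with rfl | rfl <;> omega
    have hci : coneRel U C w c i := by
      unfold coneRel
      have := hCU hc
      tauto
    have hcj : coneRel U C w c j := by
      unfold coneRel
      have := hCU hc
      tauto
    -- the exchange passes through `c`, by the Plücker type relation between three columns
    have hz : ∃ z : V ⊕ V, t z ≠ 0 ∧ X z * edgeBinomial K i j ∈ edgeIdeal K ∅ ∅ (coneRel U C w) := by
      rcases hc0 with hc0 | hc0
      · refine ⟨_, hc0, ?_⟩
        have e : X (Sum.inl c) * edgeBinomial K i j =
            X (Sum.inl i) * edgeBinomial K c j - X (Sum.inl j) * edgeBinomial K c i := by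
          unfold edgeBinomial
          ring
        rw [e]
        exact Ideal.sub_mem _ (Ideal.mul_mem_left _ _ (edgeBinomial_mem hcj))
          (Ideal.mul_mem_left _ _ (edgeBinomial_mem hci))
      · refine ⟨_, hc0, ?_⟩
        have e : X (Sum.inr c) * edgeBinomial K i j =
            X (Sum.inr i) * edgeBinomial K c j - X (Sum.inr j) * edgeBinomial K c i := by
          unfold edgeBinomial
          ring
        rw [e]
        exact Ideal.sub_mem _ (Ideal.mul_mem_left _ _ (edgeBinomial_mem hcj))
          (Ideal.mul_mem_left _ _ (edgeBinomial_mem hci))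
    obtain ⟨z, hz0, hz⟩ := hz
    have e : (monomial t 1 : MvPolynomial (V ⊕ V) K) =
        monomial (t - Finsupp.single z 1) 1 * X z := by
      rw [X, monomial_mul, tsub_add_cancel_of_le, one_mul]
      intro k
      by_cases hk : k = z
      · subst hk
        simp
        omega
      · simp [Ne.symm hk]
    rw [e, mul_assoc]
    exact Ideal.mul_mem_left _ _ hz
  rw [edgeBinomial_eq, mul_sub, monomial_mul, monomial_mul, one_mul] at hgen
  have hinv := invariantMap_eq_zero_of_mem_span (coneRel_generators hCU hw) hgen
  rw [map_sub, invariantMap_monomial, invariantMap_monomial, sub_eq_zero] at hinv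
  have hinv' := Finsupp.single_left_injective (one_ne_zero (α := K)) hinv
  have := ih _ ?_ (hinv'.trans h) rfl
  · have := Ideal.sub_mem _ this hgen
    rwa [sub_sub_sub_cancel_left] at this
  · have hti : t (Sum.inr i) + 1 > v (Sum.inr i) := by simpa using hi
    have htj : t (Sum.inr j) < v (Sum.inr j) := by simpa [Finsupp.single_apply, hij] using hj
    refine Finset.sum_lt_sum (fun k _ => ?_) ⟨i, Finset.mem_univ i, ?_⟩
    · by_cases hk : k = j
      · subst hk
        simp
        omega
      · simp [Ne.symm hk]
        omega
    · simp [Ne.symm hij]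
      omega

theorem mem_edgeIdeal_of_X_mul_mem {U C : Finset V} {w : V} (hCU : C ⊆ U) (hw : w ∉ U)
    {f : MvPolynomial (V ⊕ V) K} (hf : X (Sum.inl w) * f ∈ edgeIdeal K ∅ ∅ (coneRel U C w)) :
    f ∈ edgeIdeal K ∅ ∅ (coneRel U C w) :=
  mem_span_of_X_mul_mem_of_invariant (coneRel_generators hCU hw)
    (fun _ _ => monomial_sub_mem_of_coneInvariant_eq hCU hw)
    (fun _ _ h => coneInvariant_X_cancel (fun h' => hw (hCU h')) h) hf

end EdgeIdeal

/-! ### Bounds for the ideals of cliques and cones -/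

section EdgeIdealBounds

variable {V : Type*} {K : Type*} [Field K]

/-- The edges of the complete graph on `U`, with loops. -/
def cliqueRel (U : Finset V) (i j : V) : Prop := i ∈ U ∧ j ∈ U

theorem isGradedIdeal_edgeIdeal (A B : Finset V) (E : V → V → Prop) :
    IsGradedIdeal (edgeIdeal K A B E) := by
  refine isGradedIdeal_span ?_
  rintro _ (⟨v, _, rfl⟩ | ⟨i, j, _, rfl⟩)
  · exact ⟨1, isHomogeneous_X K v⟩
  · exact ⟨2, ((isHomogeneous_X K _).mul (isHomogeneous_X K _)).sub
      ((isHomogeneous_X K _).mul (isHomogeneous_X K _))⟩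

theorem edgeIdeal_le {A B : Finset V} {E : V → V → Prop} {J : Ideal (MvPolynomial (V ⊕ V) K)}
    (hA : ∀ a ∈ A, X (Sum.inl a) ∈ J) (hB : ∀ b ∈ B, X (Sum.inr b) ∈ J)
    (hE : ∀ i j, E i j → edgeBinomial K i j ∈ J) : edgeIdeal K A B E ≤ J := by
  refine Ideal.span_le.2 ?_
  rintro _ (⟨v | v, hv, rfl⟩ | ⟨i, j, h, rfl⟩)
  · exact hA v (by simpa using hv)
  · exact hB v (by simpa using hv)
  · exact hE i j h

theorem edgeIdeal_le_edgeIdeal {A B A' B' : Finset V} {E E' : V → V → Prop} (hA : A ⊆ A')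
    (hB : B ⊆ B') (hE : ∀ i j, E i j → edgeBinomial K i j ∈ edgeIdeal K A' B' E') :
    edgeIdeal K A B E ≤ edgeIdeal K A' B' E' :=
  edgeIdeal_le (fun _ h => X_inl_mem_edgeIdeal (hA h)) (fun _ h => X_inr_mem_edgeIdeal (hB h)) hE

/-- A binomial lies in an ideal that contains a variable of each of its two terms. -/
theorem edgeBinomial_mem_of_X_mem {J : Ideal (MvPolynomial (V ⊕ V) K)} {i j : V}
    (h1 : X (Sum.inl i) ∈ J ∨ X (Sum.inr j) ∈ J) (h2 : X (Sum.inl j) ∈ J ∨ X (Sum.inr i) ∈ J) :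
    edgeBinomial K i j ∈ J := by
  refine J.sub_mem ?_ ?_
  · exact h1.elim (fun h => J.mul_mem_right _ h) fun h => J.mul_mem_left _ h
  · exact h2.elim (fun h => J.mul_mem_right _ h) fun h => J.mul_mem_left _ h

theorem edgeBinomial_mem_of_inl_mem {A B : Finset V} {E : V → V → Prop} {i j : V} (hi : i ∈ A)
    (hj : j ∈ A) : edgeBinomial K i j ∈ edgeIdeal K A B E :=
  edgeBinomial_mem_of_X_mem (Or.inl (X_inl_mem_edgeIdeal hi)) (Or.inl (X_inl_mem_edgeIdeal hj))

theorem edgeBinomial_self_mem (J : Ideal (MvPolynomial (V ⊕ V) K)) (i : V) :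
    edgeBinomial K i i ∈ J := by
  unfold edgeBinomial
  rw [sub_self]
  exact J.zero_mem

theorem X_mul_mem_edgeIdeal_of_mem {A B A' B' : Finset V} {E E' : V → V → Prop} {v : V ⊕ V}
    (hA : ∀ a ∈ A', X v * X (Sum.inl a) ∈ edgeIdeal K A B E) (hB : B' ⊆ B)
    (hE : ∀ i j, E' i j → E i j) {f : MvPolynomial (V ⊕ V) K} (hf : f ∈ edgeIdeal K A' B' E') :
    X v * f ∈ edgeIdeal K A B E := by
  have h : edgeIdeal K A' B' E' ≤ Submodule.comap
      (LinearMap.mulLeft (MvPolynomial (V ⊕ V) K) (X v)) (edgeIdeal K A B E) := by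
    refine edgeIdeal_le hA (fun b hb => ?_) (fun i j hij => ?_)
    · exact Ideal.mul_mem_left _ _ (X_inr_mem_edgeIdeal (hB hb))
    · exact Ideal.mul_mem_left _ _ (edgeBinomial_mem (hE i j hij))
  exact h hf

variable [DecidableEq V]

theorem edgeIdeal_insert_left (a : V) (A B : Finset V) (E : V → V → Prop) :
    edgeIdeal K (insert a A) B E = edgeIdeal K A B E ⊔ Ideal.span {X (Sum.inl a)} := by
  refine le_antisymm (edgeIdeal_le ?_ ?_ ?_) (sup_le ?_ ?_)
  · intro v hv
    rcases Finset.mem_insert.1 hv with rfl | hv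
    · exact Ideal.mem_sup_right (Ideal.mem_span_singleton_self _)
    · exact Ideal.mem_sup_left (X_inl_mem_edgeIdeal hv)
  · exact fun v hv => Ideal.mem_sup_left (X_inr_mem_edgeIdeal hv)
  · exact fun i j h => Ideal.mem_sup_left (edgeBinomial_mem h)
  · exact edgeIdeal_le_edgeIdeal (Finset.subset_insert _ _) subset_rfl
      fun i j h => edgeBinomial_mem h
  · rw [Ideal.span_singleton_le_iff_mem]
    exact X_inl_mem_edgeIdeal (Finset.mem_insert_self _ _)

theorem edgeIdeal_insert_right (b : V) (A B : Finset V) (E : V → V → Prop) :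
    edgeIdeal K A (insert b B) E = edgeIdeal K A B E ⊔ Ideal.span {X (Sum.inr b)} := by
  refine le_antisymm (edgeIdeal_le ?_ ?_ ?_) (sup_le ?_ ?_)
  · exact fun v hv => Ideal.mem_sup_left (X_inl_mem_edgeIdeal hv)
  · intro v hv
    rcases Finset.mem_insert.1 hv with rfl | hv
    · exact Ideal.mem_sup_right (Ideal.mem_span_singleton_self _)
    · exact Ideal.mem_sup_left (X_inr_mem_edgeIdeal hv)
  · exact fun i j h => Ideal.mem_sup_left (edgeBinomial_mem h)
  · exact edgeIdeal_le_edgeIdeal subset_rfl (Finset.subset_insert _ _)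
      fun i j h => edgeBinomial_mem h
  · rw [Ideal.span_singleton_le_iff_mem]
    exact X_inr_mem_edgeIdeal (Finset.mem_insert_self _ _)

theorem notMem_vars_edgeBinomial {v : V ⊕ V} {i j : V}
    (h : v ≠ Sum.inl i ∧ v ≠ Sum.inr j ∧ v ≠ Sum.inl j ∧ v ≠ Sum.inr i) :
    v ∉ (edgeBinomial K i j).vars := by
  intro hv
  unfold edgeBinomial at hv
  have h1 := vars_sub_subset _ hv
  rw [Finset.mem_union] at h1
  rcases h1 with h1 | h1 <;>
  · have h2 := vars_mul _ _ h1
    rw [vars_X, vars_X] at h2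
    simp only [Finset.mem_union, Finset.mem_singleton] at h2
    tauto

theorem mem_edgeIdeal_of_X_inl_mul_mem {A B : Finset V} {E : V → V → Prop} {a : V} (ha : a ∉ A)
    (hE : ∀ i j, E i j → a ≠ i ∧ a ≠ j) {f : MvPolynomial (V ⊕ V) K}
    (hf : X (Sum.inl a) * f ∈ edgeIdeal K A B E) : f ∈ edgeIdeal K A B E := by
  refine mem_span_of_X_mul_mem ?_ hf
  rintro _ (⟨v, hv, rfl⟩ | ⟨i, j, h, rfl⟩)
  · rw [vars_X, Finset.mem_singleton]
    rintro rfl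
    exact ha (by simpa using hv)
  · have := hE i j h
    exact notMem_vars_edgeBinomial (by simp [this])

theorem mem_edgeIdeal_of_X_inr_mul_mem {A B : Finset V} {E : V → V → Prop} {b : V} (hb : b ∉ B)
    (hE : ∀ i j, E i j → b ≠ i ∧ b ≠ j) {f : MvPolynomial (V ⊕ V) K}
    (hf : X (Sum.inr b) * f ∈ edgeIdeal K A B E) : f ∈ edgeIdeal K A B E := by
  refine mem_span_of_X_mul_mem ?_ hf
  rintro _ (⟨v, hv, rfl⟩ | ⟨i, j, h, rfl⟩)
  · rw [vars_X, Finset.mem_singleton]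
    rintro rfl
    exact hb (by simpa using hv)
  · have := hE i j h
    exact notMem_vars_edgeBinomial (by simp [this])

variable [Fintype V]

/-- The case where the binomials are redundant, so that the ideal is generated by variables. -/
theorem cyclicBound_edgeIdeal_of_binomials_mem {A B : Finset V} {E : V → V → Prop}
    (hE : ∀ i j, E i j → edgeBinomial K i j ∈ edgeIdeal K A B (cliqueRel ∅)) :
    CyclicBound (edgeIdeal K A B E) (A.card + B.card) 0 := by
  have e : edgeIdeal K A B E = Ideal.span (X '' (A.disjSum B : Set (V ⊕ V))) := by
    refine le_antisymm ?_ (Ideal.span_mono Set.subset_union_left)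
    refine (edgeIdeal_le_edgeIdeal subset_rfl subset_rfl hE).trans (Ideal.span_mono ?_)
    rintro _ (h | ⟨i, j, h, rfl⟩)
    · exact h
    · exact absurd h.1 (Finset.notMem_empty i)
  rw [e, ← Finset.card_disjSum]
  exact cyclicBound_span_X _

/-- Each new variable that occurs in no binomial is regular, and raises the projective dimension
by one. -/
theorem CyclicBound.edgeIdeal_union {A B A' B' : Finset V} {E : V → V → Prop} {p : ℕ} {r : ℤ}
    (h : CyclicBound (edgeIdeal K A B E) p r) (hA : Disjoint A' A) (hB : Disjoint B' B)
    (hEA : ∀ i j, E i j → i ∉ A' ∧ j ∉ A') (hEB : ∀ i j, E i j → i ∉ B' ∧ j ∉ B') :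
    CyclicBound (edgeIdeal K (A' ∪ A) (B' ∪ B) E) (p + A'.card + B'.card) r := by
  induction A' using Finset.induction_on with
  | empty =>
    rw [Finset.empty_union, Finset.card_empty, add_zero]
    clear hEA hA
    induction B' using Finset.induction_on with
    | empty => simpa using h
    | insert b B' hb ih =>
      rw [Finset.disjoint_insert_left] at hB
      rw [Finset.insert_union, edgeIdeal_insert_right, Finset.card_insert_of_notMem hb, ← add_assoc]
      refine CyclicBound.sup_X (isGradedIdeal_edgeIdeal _ _ _) _
        (fun f => mem_edgeIdeal_of_X_inr_mul_mem (by simp [hb, hB.1]) ?_) (ih hB.2 ?_)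
      · intro i j hij
        have := hEB i j hij
        grind
      · intro i j hij
        have := hEB i j hij
        grind
  | insert a A' ha ih =>
    rw [Finset.disjoint_insert_left] at hA
    rw [Finset.insert_union, edgeIdeal_insert_left, Finset.card_insert_of_notMem ha, ← add_assoc,
      add_right_comm _ 1]
    refine CyclicBound.sup_X (isGradedIdeal_edgeIdeal _ _ _) _
      (fun f => mem_edgeIdeal_of_X_inl_mul_mem (by simp [ha, hA.1]) ?_) (ih hA.2 ?_)
    · intro i j hij
      have := hEA i j hij
      grind
    · intro i j hij
      have := hEA i j hij
      grind

theorem CyclicBound.edgeIdeal_clique {U A B : Finset V} {p : ℕ} {r : ℤ}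
    (h : CyclicBound (edgeIdeal K ∅ ∅ (cliqueRel U)) p r) (hA : Disjoint A U) (hB : Disjoint B U) :
    CyclicBound (edgeIdeal K A B (cliqueRel U)) (p + A.card + B.card) r := by
  have := h.edgeIdeal_union (A' := A) (B' := B) (Finset.disjoint_empty_right _)
    (Finset.disjoint_empty_right _)
    (fun i j hij => ⟨Finset.disjoint_right.1 hA hij.1, Finset.disjoint_right.1 hA hij.2⟩)
    (fun i j hij => ⟨Finset.disjoint_right.1 hB hij.1, Finset.disjoint_right.1 hB hij.2⟩)
  simpa using this

/-- The reduction modulo the regular variable `x_w`: the colon ideal by `y_w` is generated by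
`x_w`, the `x_c` with `c ∈ C` and the binomials of the clique `U`; adding `y_w` isolates `w`. -/
theorem CyclicBound.cone {U C : Finset V} {w : V} (hCU : C ⊆ U) (hw : w ∉ U) {p : ℕ} {r : ℤ}
    (h1 : CyclicBound (edgeIdeal K (insert w C) ∅ (cliqueRel U)) (p + 1) (r - 1))
    (h2 : CyclicBound (edgeIdeal K {w} {w} (cliqueRel U)) (p + 1) r) :
    CyclicBound (edgeIdeal K ∅ ∅ (coneRel U C w)) p r := by
  refine CyclicBound.of_sup_X (isGradedIdeal_edgeIdeal _ _ _) (Sum.inl w)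
    (fun f => mem_edgeIdeal_of_X_mul_mem hCU hw) ?_
  rw [← edgeIdeal_insert_left]
  refine CyclicBound.of_colon (I := edgeIdeal K (insert w ∅) ∅ (coneRel U C w))
    (isGradedIdeal_edgeIdeal _ _ _) (Sum.inr w) (fun f => ⟨fun hf => ?_,
    X_mul_mem_edgeIdeal_of_mem ?_ subset_rfl fun i j h => Or.inl h⟩) h1 ?_
  · refine mem_edgeIdeal_of_X_inr_mul_mem (Finset.notMem_empty w) ?_
      (edgeIdeal_le_edgeIdeal ?_ subset_rfl ?_ hf)
    · rintro i j h
      exact ⟨fun e => hw (e ▸ h.1), fun e => hw (e ▸ h.2)⟩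
    · exact Finset.insert_subset_insert _ (Finset.empty_subset _)
    · rintro i j (h | ⟨rfl, h⟩ | ⟨rfl, h⟩)
      · exact edgeBinomial_mem h
      · exact edgeBinomial_mem_of_inl_mem (by simp) (by simp [h])
      · exact edgeBinomial_mem_of_inl_mem (by simp [h]) (by simp)
  · intro a ha
    rcases Finset.mem_insert.1 ha with rfl | ha
    · exact Ideal.mul_mem_left _ _ (X_inl_mem_edgeIdeal (by simp))
    · have e : X (Sum.inr w) * X (Sum.inl a) =
          edgeBinomial K a w + X (Sum.inr a) * X (Sum.inl w) := by
        unfold edgeBinomial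
        ring
      rw [e]
      exact Ideal.add_mem _ (edgeBinomial_mem (Or.inr (Or.inr ⟨rfl, ha⟩)))
        (Ideal.mul_mem_left _ _ (X_inl_mem_edgeIdeal (by simp)))
  · rw [← edgeIdeal_insert_right]
    have e : edgeIdeal K (insert w ∅) (insert w ∅) (coneRel U C w) =
        edgeIdeal K {w} {w} (cliqueRel U) := by
      refine le_antisymm (edgeIdeal_le_edgeIdeal subset_rfl subset_rfl ?_)
        (edgeIdeal_le_edgeIdeal subset_rfl subset_rfl fun i j h => edgeBinomial_mem (Or.inl h))
      rintro i j (h | ⟨rfl, _⟩ | ⟨rfl, _⟩)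
      · exact edgeBinomial_mem h
      · exact edgeBinomial_mem_of_X_mem (Or.inl (X_inl_mem_edgeIdeal (by simp)))
          (Or.inr (X_inr_mem_edgeIdeal (by simp)))
      · exact edgeBinomial_mem_of_X_mem (Or.inr (X_inr_mem_edgeIdeal (by simp)))
          (Or.inl (X_inl_mem_edgeIdeal (by simp)))
    rwa [e]

/-- The ideal of `2`-minors of a generic `2 × |U|` matrix has a linear resolution, of the length
given by Eagon and Northcott. -/
theorem cyclicBound_clique (U : Finset V) :
    CyclicBound (edgeIdeal K ∅ ∅ (cliqueRel U)) (U.card - 1) 1 := by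
  induction U using Finset.induction_on with
  | empty =>
    exact (cyclicBound_edgeIdeal_of_binomials_mem fun i j h => edgeBinomial_mem h).mono
      (Nat.zero_le _) zero_le_one
  | insert w U hw ih =>
    rw [Finset.card_insert_of_notMem hw, Nat.add_sub_cancel]
    rcases U.eq_empty_or_nonempty with rfl | hU
    · refine (cyclicBound_edgeIdeal_of_binomials_mem fun i j h => ?_).mono
        (Nat.zero_le _) zero_le_one
      obtain rfl : i = w := by simpa using h.1
      obtain rfl : j = i := by simpa using h.2
      exact edgeBinomial_self_mem _ _
    have hcard := Finset.card_pos.2 hU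
    have e : edgeIdeal K ∅ ∅ (cliqueRel (insert w U)) = edgeIdeal K ∅ ∅ (coneRel U U w) := by
      refine le_antisymm (edgeIdeal_le_edgeIdeal subset_rfl subset_rfl ?_)
        (edgeIdeal_le_edgeIdeal subset_rfl subset_rfl fun i j h => edgeBinomial_mem ?_)
      · rintro i j ⟨hi, hj⟩
        by_cases hij : i = w ∧ j = w
        · obtain ⟨rfl, rfl⟩ := hij
          exact edgeBinomial_self_mem _ _
        · refine edgeBinomial_mem ?_
          unfold coneRel
          grind
      · unfold coneRel at h
        unfold cliqueRel
        grind
    rw [e]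
    refine CyclicBound.cone subset_rfl hw ?_ ?_
    · refine (cyclicBound_edgeIdeal_of_binomials_mem fun i j h => ?_).mono ?_ (by simp)
      · exact edgeBinomial_mem_of_inl_mem (by simp [h.1]) (by simp [h.2])
      · simp [Finset.card_insert_of_notMem hw]
    · refine (ih.edgeIdeal_clique (by simpa using hw) (by simpa using hw)).mono ?_ le_rfl
      simp only [Finset.card_singleton]
      omega

/-- The colon ideal of `CyclicBound.cone`. The variables `y_c`, `c ∈ C`, are added one at a time;
each colon ideal on the way is generated by variables. -/
theorem cyclicBound_colon {U C : Finset V} {w : V} (hCU : C ⊂ U) (hw : w ∉ U) (Y : Finset V)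
    (hY : Y ⊆ C) :
    CyclicBound (edgeIdeal K (insert w C) Y (cliqueRel U)) (C.card + U.card) 1 := by
  have hwC : w ∉ C := fun h => hw (hCU.1 h)
  have hlt := Finset.card_lt_card hCU
  induction hk : (C \ Y).card generalizing Y with
  | zero =>
    obtain rfl : Y = C := hY.antisymm
      (Finset.sdiff_eq_empty_iff_subset.1 (Finset.card_eq_zero.1 hk))
    have e : edgeIdeal K (insert w Y) Y (cliqueRel U) =
        edgeIdeal K (insert w Y) Y (cliqueRel (U \ Y)) := by
      refine le_antisymm (edgeIdeal_le_edgeIdeal subset_rfl subset_rfl ?_)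
        (edgeIdeal_le_edgeIdeal subset_rfl subset_rfl fun i j h => edgeBinomial_mem ?_)
      · rintro i j ⟨hi, hj⟩
        by_cases hiY : i ∈ Y
        · exact edgeBinomial_mem_of_X_mem (Or.inl (X_inl_mem_edgeIdeal (by simp [hiY])))
            (Or.inr (X_inr_mem_edgeIdeal hiY))
        by_cases hjY : j ∈ Y
        · exact edgeBinomial_mem_of_X_mem (Or.inr (X_inr_mem_edgeIdeal hjY))
            (Or.inl (X_inl_mem_edgeIdeal (by simp [hjY])))
        exact edgeBinomial_mem ⟨by simp [hi, hiY], by simp [hj, hjY]⟩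
      · exact ⟨(Finset.mem_sdiff.1 h.1).1, (Finset.mem_sdiff.1 h.2).1⟩
    rw [e]
    refine ((cyclicBound_clique (U \ Y)).edgeIdeal_clique ?_ Finset.disjoint_sdiff).mono ?_ le_rfl
    · rw [Finset.disjoint_insert_left]
      exact ⟨by simp [hw], Finset.disjoint_sdiff⟩
    · rw [Finset.card_insert_of_notMem hwC, Finset.card_sdiff_of_subset hCU.1]
      omega
  | succ k ih =>
    obtain ⟨c, hc⟩ : (C \ Y).Nonempty := Finset.card_pos.1 (by omega)
    obtain ⟨hcC, hcY⟩ := Finset.mem_sdiff.1 hc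
    refine CyclicBound.of_colon (I' := edgeIdeal K (insert w U) Y (cliqueRel ∅))
      (isGradedIdeal_edgeIdeal _ _ _) (Sum.inr c) (fun f => ⟨fun hf => ?_,
      X_mul_mem_edgeIdeal_of_mem ?_ subset_rfl fun i j h => ?_⟩) ?_ ?_
    · refine mem_edgeIdeal_of_X_inr_mul_mem hcY ?_ (edgeIdeal_le_edgeIdeal
        (Finset.insert_subset_insert _ hCU.1) subset_rfl (fun i j h => ?_) hf)
      · exact fun i j h => absurd h.1 (Finset.notMem_empty i)
      · exact edgeBinomial_mem_of_inl_mem (by simp [h.1]) (by simp [h.2])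
    · intro a ha
      rcases Finset.mem_insert.1 ha with rfl | ha
      · exact Ideal.mul_mem_left _ _ (X_inl_mem_edgeIdeal (by simp))
      · have e : X (Sum.inr c) * X (Sum.inl a) =
            edgeBinomial K a c + X (Sum.inr a) * X (Sum.inl c) := by
          unfold edgeBinomial
          ring
        rw [e]
        exact Ideal.add_mem _ (edgeBinomial_mem ⟨ha, hCU.1 hcC⟩)
          (Ideal.mul_mem_left _ _ (X_inl_mem_edgeIdeal (by simp [hcC])))
    · exact absurd h.1 (Finset.notMem_empty i)
    · refine (cyclicBound_edgeIdeal_of_binomials_mem fun i j h => edgeBinomial_mem h).mono ?_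
        (by simp)
      have h1 : Y.card < C.card := Finset.card_lt_card
        ⟨hY, fun h => hcY (h hcC)⟩
      rw [Finset.card_insert_of_notMem hw]
      omega
    · rw [← edgeIdeal_insert_right]
      refine ih (insert c Y) (Finset.insert_subset hcC hY) ?_
      rw [Finset.sdiff_insert, Finset.card_erase_of_mem hc, hk, Nat.add_sub_cancel]

theorem cyclicBound_cone {U C : Finset V} {w : V} (hCU : C ⊆ U) (hC : C.Nonempty) (hw : w ∉ U) :
    CyclicBound (edgeIdeal K ∅ ∅ (coneRel U C w)) (C.card + U.card - 1) 2 := by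
  have hC1 := Finset.card_pos.2 hC
  have hU1 := Finset.card_le_card hCU
  refine CyclicBound.cone hCU hw ?_ ?_
  · rw [Nat.sub_add_cancel (by omega)]
    rcases hCU.eq_or_ssubset with rfl | hCU
    · refine (cyclicBound_edgeIdeal_of_binomials_mem fun i j h => ?_).mono ?_ (by norm_num)
      · exact edgeBinomial_mem_of_inl_mem (by simp [h.1]) (by simp [h.2])
      · rw [Finset.card_insert_of_notMem hw, Finset.card_empty]
        omega
    · exact cyclicBound_colon hCU hw ∅ (Finset.empty_subset _)
  · refine ((cyclicBound_clique U).edgeIdeal_clique (by simpa using hw) (by simpa using hw)).mono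
      ?_ (by norm_num)
    simp only [Finset.card_singleton]
    omega

end EdgeIdealBounds

theorem binomialEdgeIdeal_completeWithVertex (K : Type*) [Field K] {n m : ℕ} (hn : 0 < n)
    {U C : Finset (Fin n)} (hU : ∀ a, a ∈ U ↔ (a : ℕ) + 1 < n)
    (hC : ∀ a, a ∈ C ↔ m ≤ (a : ℕ) + 1 ∧ (a : ℕ) + 1 < n) :
    binomialEdgeIdeal K (completeWithVertex n m) =
      edgeIdeal K ∅ ∅ (coneRel U C ⟨n - 1, by omega⟩) := by
  apply le_antisymm
  · refine Ideal.span_le.2 ?_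
    rintro _ ⟨i, j, h, rfl⟩
    refine edgeBinomial_mem ?_
    simp only [completeWithVertex, SimpleGraph.fromRel_adj] at h
    simp only [coneRel, hU, hC, Fin.ext_iff]
    omega
  · refine edgeIdeal_le (by simp) (by simp) fun i j h => ?_
    by_cases hij : i = j
    · subst hij
      exact edgeBinomial_self_mem _ _
    · refine Ideal.subset_span ⟨i, j, ?_, rfl⟩
      simp only [coneRel, hU, hC, Fin.ext_iff] at h hij
      simp only [completeWithVertex, SimpleGraph.fromRel_adj, ne_eq, Fin.ext_iff]
      omega

theorem mainTheorem9 (K : Type*) [Field K] (n m : ℕ) (hm : 1 ≤ m) (hmn : m ≤ n - 1) :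
    projDim (binomialEdgeIdeal K (completeWithVertex n m)) ≤
        (((2 * n - m - 3 : ℕ) : ℕ∞) : WithBot ℕ∞) ∧
      regularity (binomialEdgeIdeal K (completeWithVertex n m)) ≤ 3 := by
  let U : Finset (Fin n) := (Finset.range (n - 1)).attachFin fun a ha => by
    have := Finset.mem_range.1 ha
    omega
  let C : Finset (Fin n) := (Finset.Ico (m - 1) (n - 1)).attachFin fun a ha => by
    have := Finset.mem_Ico.1 ha
    omega
  have hU : ∀ a, a ∈ U ↔ (a : ℕ) + 1 < n := fun a => by
    rw [Finset.mem_attachFin, Finset.mem_range]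
    omega
  have hC : ∀ a, a ∈ C ↔ m ≤ (a : ℕ) + 1 ∧ (a : ℕ) + 1 < n := fun a => by
    rw [Finset.mem_attachFin, Finset.mem_Ico]
    omega
  have hUcard : U.card = n - 1 := by rw [Finset.card_attachFin, Finset.card_range]
  have hCcard : C.card = n - m := by
    rw [Finset.card_attachFin, Nat.card_Ico]
    omega
  have h := cyclicBound_cone (K := K) (U := U) (C := C) (w := ⟨n - 1, by omega⟩)
    (fun a ha => (hU a).2 ((hC a).1 ha).2) (Finset.card_pos.1 (by omega))
    (fun h => by
      have := (hU _).1 h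
      simp only at this
      omega)
  rw [← binomialEdgeIdeal_completeWithVertex K (by omega) hU hC, hUcard, hCcard,
    show n - m + (n - 1) - 1 = 2 * n - m - 3 + 1 by omega] at h
  refine ⟨h.projDim_le (by norm_num), (h.regularity_le (by norm_num)).trans_eq ?_⟩
  norm_num
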